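/- Let $n$ and $k$ be integers with $0\le k\le 2n$. An $(a,b,c,d,e,f)$ hexagon is a hexagon with all angles equal to $120^\circ$ and sides of lengths $a,b,c,d,e,f$ in clockwise order, with the side of length $b$ at the top (sides of length $0$ being allowed), subdivided into equilateral triangles of unit side by lines parallel to the sides. A lozenge is the union of two unit triangles with a common edge. In the $(k,\,2n+1-k,\,k,\,k+1,\,2n-k,\,k+1)$ hexagon, the horizontal line through the leftmost and rightmost vertices has length $2n+1$; the central triangle is the unit triangle of the hexagon that lies below this line and has the middle unit segment of this line as an edge. Let $N(n,k)$ be the number of tilings by lozenges of the region obtained from this hexagon by removing the central triangle. Then, for every integer $q\ge 0$, $$N(n,k)=\frac{\prod_{i=0}^{q}\bigl((n-i)(n+i+1)\bigr)^{4(q-i)+1}}{2^{2q(2q+1)}\prod_{j=1}^{q}(2j+1)^{8(q-j)+2}} =\frac{(n-q)(n-q+1)^5\cdots n^{4q+1}(n+1)^{4q+1}\cdots(n+q+1)}{2^{2q(2q+1)}\,3^{8(q-1)+2}\,5^{8(q-2)+2}\cdots(2q+1)^2}\quad\text{if } k=2q+1,$$ $$N(n,k)=\frac{\prod_{i=0}^{q-1}\bigl((n-i)(n+i+1)\bigr)^{4(q-i)-1}}{2^{(2q-1)2q}\prod_{j=1}^{q-1}(2j+1)^{8(q-j)-2}}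 =\frac{(n-q+1)^3\cdots n^{4q-1}(n+1)^{4q-1}\cdots(n+q)^3}{2^{(2q-1)(2q)}\,3^{8(q-1)-2}\,5^{8(q-2)-2}\cdots(2q-1)^6}\quad\text{if } k=2q.$$ Empty products are $1$. -/

import Mathlib

/-- A unit triangle of the triangular lattice. The pair `(x, y) : ℤ × ℤ` stands for the lattice
point `x • e₁ + y • e₂`, where `e₁ = (1, 0)` and `e₂ = (1/2, √3/2)`. The triangle with corner
`(x, y)` points upward if `up = true` and downward otherwise; see `UnitTriangle.vertices`. -/
structure UnitTriangle where
  x : ℤ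
  y : ℤ
  up : Bool

/-- The three vertices of a unit triangle. -/
def UnitTriangle.vertices (t : UnitTriangle) : Finset (ℤ × ℤ) :=
  if t.up then {(t.x, t.y), (t.x + 1, t.y), (t.x, t.y + 1)}
  else {(t.x + 1, t.y), (t.x, t.y + 1), (t.x + 1, t.y + 1)}

/-- A lozenge is the union of two unit triangles that have a common edge, that is, exactly two
common vertices. It is represented by the set of these two triangles. -/
def IsLozenge (L : Set UnitTriangle) : Prop :=
  ∃ s t : UnitTriangle, (s.vertices ∩ t.vertices).card = 2 ∧ L = {s, t}

/-- `T` is a tiling by lozenges of the region `R` (a set of unit triangles): its members are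
lozenges contained in `R`, and each unit triangle of `R` lies in exactly one of them. -/
def IsLozengeTiling (R : Set UnitTriangle) (T : Set (Set UnitTriangle)) : Prop :=
  (∀ L ∈ T, IsLozenge L ∧ L ⊆ R) ∧ ∀ t ∈ R, ∃! L, L ∈ T ∧ t ∈ L

/-- The number of lozenge tilings of a region. -/
noncomputable def numLozengeTilings (R : Set UnitTriangle) : ℕ :=
  {T : Set (Set UnitTriangle) | IsLozengeTiling R T}.ncard

/-- The condition on the side lengths under which an `(a, b, c, d, e, f)` hexagon with all angles
equal to 120 degrees exists. -/
def HexagonCloses (a b c d e f : ℕ) : Prop :=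
  (a : ℤ) - d = c - f ∧ (c : ℤ) - f = e - b

/-- The unit triangles of the `(a, b, c, d, e, f)` hexagon, placed so that its leftmost vertex, the
one between the sides of lengths `f` and `a`, is the origin. Its vertices, in clockwise order, are
`(0, 0)`, `(0, a)`, `(b, a)`, `(b + c, a - c)`, `(b + c, a - c - d) = (e + f, -f)` and `(f, -f)`,
so that the side of length `b` is the top and the side of length `e` is the bottom. A unit triangle
belongs to the hexagon if its vertices satisfy the six inequalities of the sides of lengths
`a`, `b`, `c`, `d`, `e`, `f` (in this order). -/
def hexagon (a b c d e f : ℕ) : Set UnitTriangle :=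
  {t | HexagonCloses a b c d e f ∧ ∀ p ∈ t.vertices,
    0 ≤ p.1 ∧ p.2 ≤ a ∧ p.1 + p.2 ≤ a + b ∧ p.1 ≤ b + c ∧ -(f : ℤ) ≤ p.2 ∧ 0 ≤ p.1 + p.2}

/-- The central triangle of the `(k, 2n+1-k, k, k+1, 2n-k, k+1)` hexagon. The horizontal line
through the leftmost vertex `(0, 0)` and the rightmost vertex `(2n+1, 0)` has length `2n+1`, and
the central triangle is the downward triangle below the middle unit segment of this line: its
vertices are `(n, 0)`, `(n+1, 0)` and `(n+1, -1)`. -/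
def centralTriangle (n : ℕ) : UnitTriangle := ⟨n, -1, false⟩

/-- Number of lozenge tilings of the `(k, 2n+1-k, k, k+1, 2n-k, k+1)` hexagon without its central
triangle. The subtractions are meant for `k ≤ 2n`, when the hexagon exists. -/
noncomputable def numTilingsNoCenter (n k : ℕ) : ℕ :=
  numLozengeTilings
    (hexagon k (2 * n + 1 - k) k (k + 1) (2 * n - k) (k + 1) \ {centralTriangle n})

/-! Cut the hexagon along the horizontal line through its leftmost and rightmost vertices. A tiling
amounts to the set `A` of positions where a lozenge crosses this line, together with a tiling of
what remains on either side (`numLozengeTilings_union`). The upper remainder is a trapezoid with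
dents at `A`. The lower one, once reflected, is a trapezoid with dents at `A ∪ {n}`, the central
triangle being one more dent. Balancing upward against downward triangles forces `|A| = k`.

A trapezoid with dents `c 0 < ... < c (h - 1)`, where `h` is its height, has `det ((c i).choose j)`
tilings (`cast_numLozengeTilings_dentedTrapezoid`), which is the Vandermonde product of `c` divided
by `∏ i!`. So, up to factorials, `N(n, k)` is the sum over `A` of `∏ |x - n|` times the squared
Vandermonde product of `A`. By Cauchy–Binet (`det_sum_mul_eq`) this sum is one `k × k` determinant
of pairings of monic polynomials for the weight `|y|` on `{-n, ..., n}`, and the polynomials may be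
chosen freely.

The weight is even, so polynomials of definite parity give a checkerboard matrix. Its determinant
splits into two, with weights `y` and `y ^ 3` on `{1, ..., n}` and polynomials in `y ^ 2`. Different
bases for rows and columns give every entry a closed product form (`pairing_one`, `pairing_three`).
After row and column factors are removed, the entries are quotients of factorials depending on `i +
j`. Chu–Vandermonde factors such a matrix through the unitriangular Pascal matrix, and a Vandermonde
determinant remains (`abs_det_factorial_div_factorial`). The count is nonnegative, so signs can be
dropped throughout. The stated products are then identified by comparing successive ratios
(`formula_mul_prodFactorial`). -/

/-! ### Adjacency of unit triangles -/

namespace UnitTriangle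

/-- Two unit triangles are adjacent if they have a common edge. -/
def Adj (s t : UnitTriangle) : Prop := (s.vertices ∩ t.vertices).card = 2

theorem Adj.symm {s t : UnitTriangle} (h : Adj s t) : Adj t s := by
  rw [Adj, Finset.inter_comm]; exact h

theorem adj_of_inter_eq {s t : UnitTriangle} {p q : ℤ × ℤ} (hpq : p ≠ q)
    (h : ∀ r, r ∈ s.vertices ∧ r ∈ t.vertices ↔ r = p ∨ r = q) : Adj s t := by
  rw [Adj, Finset.card_eq_two]
  refine ⟨p, q, hpq, ?_⟩
  ext r
  rw [Finset.mem_inter, h]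
  simp

theorem not_adj_self (s : UnitTriangle) : ¬ Adj s s := by
  obtain ⟨x, y, u⟩ := s
  cases u <;> simp [Adj, vertices]

theorem not_adj_of_up_eq (u : Bool) (x y a b : ℤ) : ¬ Adj ⟨x, y, u⟩ ⟨a, b, u⟩ := by
  intro h
  have h' := h
  rw [Adj, Finset.card_eq_two] at h
  obtain ⟨p, q, hpq, h⟩ := h
  have hp : p ∈ vertices ⟨x, y, u⟩ ∩ vertices ⟨a, b, u⟩ := by rw [h]; simp
  have hq : q ∈ vertices ⟨x, y, u⟩ ∩ vertices ⟨a, b, u⟩ := by rw [h]; simp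
  clear h
  obtain ⟨p1, p2⟩ := p
  obtain ⟨q1, q2⟩ := q
  have : x = a ∧ y = b := by
    clear h'
    cases u
    all_goals
      simp only [vertices, Finset.mem_inter, Finset.mem_insert, Finset.mem_singleton,
        Prod.mk.injEq, Bool.false_eq_true, if_false, if_true, ne_eq] at *
      omega
  obtain ⟨rfl, rfl⟩ := this
  exact not_adj_self _ h'

theorem adj_up_iff (x y : ℤ) (s : UnitTriangle) :
    Adj ⟨x, y, true⟩ s ↔ s = ⟨x, y, false⟩ ∨ s = ⟨x - 1, y, false⟩ ∨ s = ⟨x, y - 1, false⟩ := by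
  constructor
  · intro h
    obtain ⟨a, b, u⟩ := s
    cases u
    · rw [Adj, Finset.card_eq_two] at h
      obtain ⟨p, q, hpq, h⟩ := h
      have hp : p ∈ vertices ⟨x, y, true⟩ ∩ vertices ⟨a, b, false⟩ := by rw [h]; simp
      have hq : q ∈ vertices ⟨x, y, true⟩ ∩ vertices ⟨a, b, false⟩ := by rw [h]; simp
      clear h
      obtain ⟨p1, p2⟩ := p
      obtain ⟨q1, q2⟩ := q
      simp only [vertices, Finset.mem_inter, Finset.mem_insert, Finset.mem_singleton, Prod.mk.injEq,
        if_true, Bool.false_eq_true, if_false, ne_eq, UnitTriangle.mk.injEq, and_true] at *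
      omega
    · exact absurd h (not_adj_of_up_eq _ _ _ _ _)
  · rintro (rfl | rfl | rfl)
    · refine adj_of_inter_eq (p := (x + 1, y)) (q := (x, y + 1)) (by simp) ?_
      rintro ⟨a, b⟩
      simp only [vertices, Finset.mem_insert, Finset.mem_singleton, Prod.mk.injEq,
        if_true, Bool.false_eq_true, if_false]
      omega
    · refine adj_of_inter_eq (p := (x, y)) (q := (x, y + 1)) (by simp) ?_
      rintro ⟨a, b⟩
      simp only [vertices, Finset.mem_insert, Finset.mem_singleton, Prod.mk.injEq,
        if_true, Bool.false_eq_true, if_false]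
      omega
    · refine adj_of_inter_eq (p := (x, y)) (q := (x + 1, y)) (by simp) ?_
      rintro ⟨a, b⟩
      simp only [vertices, Finset.mem_insert, Finset.mem_singleton, Prod.mk.injEq,
        if_true, Bool.false_eq_true, if_false]
      omega

theorem adj_down_iff (x y : ℤ) (s : UnitTriangle) :
    Adj ⟨x, y, false⟩ s ↔ s = ⟨x, y, true⟩ ∨ s = ⟨x + 1, y, true⟩ ∨ s = ⟨x, y + 1, true⟩ := by
  obtain ⟨a, b, u⟩ := s
  cases u
  · simp [not_adj_of_up_eq]
  · have : Adj ⟨x, y, false⟩ ⟨a, b, true⟩ ↔ Adj ⟨a, b, true⟩ ⟨x, y, false⟩ :=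
      ⟨Adj.symm, Adj.symm⟩
    rw [this, adj_up_iff]
    simp only [UnitTriangle.mk.injEq, and_true]
    omega

end UnitTriangle

/-! ### Tilings: forced lozenges and branching -/

open UnitTriangle

theorem isLozenge_iff (L : Set UnitTriangle) : IsLozenge L ↔ ∃ s t, Adj s t ∧ L = {s, t} := Iff.rfl

theorem IsLozenge.exists_adj {L : Set UnitTriangle} (hL : IsLozenge L) {t : UnitTriangle}
    (ht : t ∈ L) : ∃ s, Adj t s ∧ L = {s, t} := by
  obtain ⟨a, b, hab, rfl⟩ := (isLozenge_iff L).1 hL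
  rcases ht with rfl | ht
  · exact ⟨b, hab, Set.pair_comm _ _⟩
  · rw [Set.mem_singleton_iff] at ht
    subst ht
    exact ⟨a, hab.symm, rfl⟩

theorem IsLozenge.nonempty {L : Set UnitTriangle} (hL : IsLozenge L) : L.Nonempty := by
  obtain ⟨a, b, -, rfl⟩ := (isLozenge_iff L).1 hL
  exact ⟨a, by simp⟩

namespace IsLozengeTiling

variable {R : Set UnitTriangle} {T : Set (Set UnitTriangle)}

theorem eq_of_mem (h : IsLozengeTiling R T) {L M : Set UnitTriangle} (hL : L ∈ T) (hM : M ∈ T)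
    {t : UnitTriangle} (htL : t ∈ L) (htM : t ∈ M) : L = M :=
  (h.2 t ((h.1 L hL).2 htL)).unique ⟨hL, htL⟩ ⟨hM, htM⟩

theorem insert_lozenge {L : Set UnitTriangle} (hL : IsLozenge L) (hLR : L ⊆ R)
    (h : IsLozengeTiling (R \ L) T) : IsLozengeTiling R (insert L T) := by
  refine ⟨?_, fun t ht => ?_⟩
  · rintro M (rfl | hM)
    · exact ⟨hL, hLR⟩
    · exact ⟨(h.1 M hM).1, (h.1 M hM).2.trans Set.sdiff_subset⟩
  · by_cases htL : t ∈ L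
    · refine ⟨L, ⟨Set.mem_insert _ _, htL⟩, ?_⟩
      rintro M ⟨rfl | hM, htM⟩
      · rfl
      · exact absurd htL ((h.1 M hM).2 htM).2
    · obtain ⟨M, ⟨hM, htM⟩, huniq⟩ := h.2 t ⟨ht, htL⟩
      refine ⟨M, ⟨Set.mem_insert_of_mem _ hM, htM⟩, ?_⟩
      rintro M' ⟨rfl | hM', htM'⟩
      · exact absurd htM' htL
      · exact huniq M' ⟨hM', htM'⟩

theorem diff_lozenge {L : Set UnitTriangle} (h : IsLozengeTiling R T) (hL : L ∈ T) :
    IsLozengeTiling (R \ L) (T \ {L}) := by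
  refine ⟨fun M hM => ⟨(h.1 M hM.1).1, fun t ht => ⟨(h.1 M hM.1).2 ht, fun htL => ?_⟩⟩, ?_⟩
  · exact hM.2 (h.eq_of_mem hM.1 hL ht htL)
  · rintro t ⟨ht, htL⟩
    obtain ⟨M, ⟨hM, htM⟩, huniq⟩ := h.2 t ht
    refine ⟨M, ⟨⟨hM, ?_⟩, htM⟩, fun M' hM' => huniq M' ⟨hM'.1.1, hM'.2⟩⟩
    rintro rfl
    exact htL htM

end IsLozengeTiling

theorem finite_setOf_isLozengeTiling {R : Set UnitTriangle} (hR : R.Finite) :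
    {T | IsLozengeTiling R T}.Finite :=
  (hR.finite_subsets.finite_subsets).subset fun _ hT L hL => (hT.1 L hL).2

/-- Inserting `L` into a tiling of `R \ L` and deleting it again are mutually inverse. -/
theorem ncard_isLozengeTiling_mem {R L : Set UnitTriangle} (hL : IsLozenge L) (hLR : L ⊆ R) :
    {T | IsLozengeTiling R T ∧ L ∈ T}.ncard = numLozengeTilings (R \ L) := by
  have hnot : ∀ T, IsLozengeTiling (R \ L) T → L ∉ T := fun T hT hLT => by
    obtain ⟨t, ht⟩ := hL.nonempty
    exact ((hT.1 L hLT).2 ht).2 ht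
  have himg : {T | IsLozengeTiling R T ∧ L ∈ T} = insert L '' {T | IsLozengeTiling (R \ L) T} := by
    ext T
    constructor
    · rintro ⟨hT, hLT⟩
      exact ⟨T \ {L}, hT.diff_lozenge hLT, by simp [Set.insert_eq_of_mem hLT]⟩
    · rintro ⟨T', hT', rfl⟩
      exact ⟨hT'.insert_lozenge hL hLR, Set.mem_insert _ _⟩
  rw [himg, Set.InjOn.ncard_image, numLozengeTilings]
  intro T₁ h₁ T₂ h₂ h
  have := congrArg (· \ {L}) h
  simpa [Set.insert_sdiff_of_mem, Set.sdiff_singleton_eq_self (hnot _ h₁),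
    Set.sdiff_singleton_eq_self (hnot _ h₂)] using this

theorem numLozengeTilings_eq_zero {R : Set UnitTriangle} {t : UnitTriangle} (ht : t ∈ R)
    (h : ∀ s ∈ R, ¬ Adj t s) : numLozengeTilings R = 0 := by
  have : {T | IsLozengeTiling R T} = ∅ := by
    rw [Set.eq_empty_iff_forall_notMem]
    intro T hT
    obtain ⟨L, ⟨hL, htL⟩, -⟩ := hT.2 t ht
    obtain ⟨s, hs, rfl⟩ := (hT.1 L hL).1.exists_adj htL
    exact h s ((hT.1 _ hL).2 (by simp)) hs
  rw [numLozengeTilings, this, Set.ncard_empty]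

theorem numLozengeTilings_eq_of_forced {R : Set UnitTriangle} {t s : UnitTriangle} (ht : t ∈ R)
    (hs : s ∈ R) (hts : Adj t s) (h : ∀ u ∈ R, Adj t u → u = s) :
    numLozengeTilings R = numLozengeTilings (R \ {s, t}) := by
  rw [← ncard_isLozengeTiling_mem ((isLozenge_iff _).2 ⟨s, t, hts.symm, rfl⟩)
    (Set.insert_subset hs (Set.singleton_subset_iff.2 ht)), numLozengeTilings]
  congr 1
  ext T
  refine ⟨fun hT => ⟨hT, ?_⟩, fun hT => hT.1⟩
  obtain ⟨L, ⟨hL, htL⟩, -⟩ := hT.2 t ht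
  obtain ⟨u, hu, rfl⟩ := (hT.1 L hL).1.exists_adj htL
  rwa [h u ((hT.1 _ hL).2 (by simp)) hu] at hL

theorem numLozengeTilings_eq_add {R : Set UnitTriangle} (hR : R.Finite) {t s s' : UnitTriangle}
    (ht : t ∈ R) (hs : s ∈ R) (hs' : s' ∈ R) (hts : Adj t s) (hts' : Adj t s') (hss' : s ≠ s')
    (h : ∀ u ∈ R, Adj t u → u = s ∨ u = s') :
    numLozengeTilings R = numLozengeTilings (R \ {s, t}) + numLozengeTilings (R \ {s', t}) := by
  rw [← ncard_isLozengeTiling_mem ((isLozenge_iff _).2 ⟨s, t, hts.symm, rfl⟩)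
    (Set.insert_subset hs (Set.singleton_subset_iff.2 ht)),
    ← ncard_isLozengeTiling_mem ((isLozenge_iff _).2 ⟨s', t, hts'.symm, rfl⟩)
    (Set.insert_subset hs' (Set.singleton_subset_iff.2 ht)), numLozengeTilings,
    ← Set.ncard_union_eq _ ((finite_setOf_isLozengeTiling hR).subset fun _ h => h.1)
    ((finite_setOf_isLozengeTiling hR).subset fun _ h => h.1)]
  · congr 1
    ext T
    refine ⟨fun hT => ?_, fun hT => hT.elim And.left And.left⟩
    obtain ⟨L, ⟨hL, htL⟩, -⟩ := hT.2 t ht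
    obtain ⟨u, hu, rfl⟩ := (hT.1 L hL).1.exists_adj htL
    rcases h u ((hT.1 _ hL).2 (by simp)) hu with rfl | rfl
    · exact Or.inl ⟨hT, hL⟩
    · exact Or.inr ⟨hT, hL⟩
  · rw [Set.disjoint_left]
    rintro T ⟨hT, h₁⟩ ⟨-, h₂⟩
    have he := hT.eq_of_mem h₁ h₂ (t := t) (by simp) (by simp)
    have : s ∈ ({s', t} : Set UnitTriangle) := he ▸ (by simp)
    have htne : s ≠ t := by
      rintro rfl
      exact not_adj_self _ hts
    rcases this with h3 | h3
    · exact hss' h3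
    · exact htne h3

theorem numLozengeTilings_empty : numLozengeTilings ∅ = 1 := by
  have : {T | IsLozengeTiling ∅ T} = {∅} := by
    ext T
    rw [Set.mem_singleton_iff]
    constructor
    · intro hT
      rw [Set.eq_empty_iff_forall_notMem]
      intro L hL
      obtain ⟨t, ht⟩ := (hT.1 L hL).1.nonempty
      exact (hT.1 L hL).2 ht
    · rintro rfl
      exact ⟨by simp, by simp⟩
  rw [numLozengeTilings, this, Set.ncard_singleton]

open Classical in
theorem numLozengeTilings_eq_ite_add_ite {R : Set UnitTriangle} (hR : R.Finite)
    {t s s' : UnitTriangle} (ht : t ∈ R) (hts : Adj t s) (hts' : Adj t s') (hss' : s ≠ s')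
    (h : ∀ u ∈ R, Adj t u → u = s ∨ u = s') :
    numLozengeTilings R = (if s ∈ R then numLozengeTilings (R \ {s, t}) else 0) +
      (if s' ∈ R then numLozengeTilings (R \ {s', t}) else 0) := by
  split_ifs with hs hs' hs'
  · exact numLozengeTilings_eq_add hR ht hs hs' hts hts' hss' h
  · rw [numLozengeTilings_eq_of_forced ht hs hts, add_zero]
    intro u hu hau
    exact (h u hu hau).resolve_right fun e => hs' (e ▸ hu)
  · rw [numLozengeTilings_eq_of_forced ht hs' hts', zero_add]
    intro u hu hau
    exact (h u hu hau).resolve_left fun e => hs (e ▸ hu)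
  · rw [numLozengeTilings_eq_zero ht]
    intro u hu hau
    rcases h u hu hau with rfl | rfl
    · exact hs hu
    · exact hs' hu

/-! ### Trapezoids with dents, scanned along the bottom row -/

/-- The part of the trapezoid `0 ≤ x`, `x + y ≤ m`, `y₀ ≤ y ≤ H` that is left when the unit triangles
of the bottom row with `x < l`, the upward unit triangles of the bottom row with `x ∈ A` and the
upward unit triangles of the next row with `x ∈ B` have been removed. -/
def dentedTrapezoid (y₀ H m l : ℤ) (A B : Set ℤ) : Set UnitTriangle :=
  {t | (y₀ ≤ t.y ∧ t.y < H ∧ 0 ≤ t.x ∧ t.x + t.y < m ∧ (t.up = false → t.x + t.y + 1 < m)) ∧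
    (t.y = y₀ → l ≤ t.x) ∧ (t.up = true → t.y = y₀ → t.x ∉ A) ∧
    (t.up = true → t.y = y₀ + 1 → t.x ∉ B)}

theorem finite_setOf_mem_Icc (a b c d : ℤ) :
    {t : UnitTriangle | t.x ∈ Set.Icc a b ∧ t.y ∈ Set.Icc c d}.Finite := by
  refine Set.Finite.of_injOn (f := fun t : UnitTriangle => (t.x, t.y, t.up))
    (t := Set.Icc a b ×ˢ Set.Icc c d ×ˢ Set.univ) ?_ ?_ ?_
  · intro t ht
    exact ⟨ht.1, ht.2, trivial⟩
  · rintro ⟨x, y, u⟩ - ⟨x', y', u'⟩ - h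
    simpa using h
  · exact (Set.finite_Icc a b).prod ((Set.finite_Icc c d).prod Set.finite_univ)

theorem finite_dentedTrapezoid (y₀ H m l : ℤ) (A B : Set ℤ) :
    (dentedTrapezoid y₀ H m l A B).Finite := by
  refine (finite_setOf_mem_Icc 0 (m - y₀) y₀ H).subset ?_
  rintro ⟨x, y, u⟩ ⟨⟨h1, h2, h3, h4, -⟩, -⟩
  simp only [Set.mem_Icc, Set.mem_ofPred_eq] at *
  omega

section regions

variable {y₀ H m l : ℤ} {A A' B B' : Set ℤ}

theorem dentedTrapezoid_diff_pair :
    dentedTrapezoid y₀ H m l A B \ {⟨l, y₀, false⟩, ⟨l, y₀, true⟩} =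
      dentedTrapezoid y₀ H m (l + 1) A B := by
  ext ⟨x, y, u⟩
  cases u <;> simp [dentedTrapezoid] <;> grind

/-- The dent at `l` moves one place to the right. Only positions beyond `l` matter for `A'`, since
the earlier ones have left the region. -/
theorem dentedTrapezoid_diff_right (hl : l ∈ A)
    (hA : ∀ x, l < x → (x ∈ A' ↔ x ∈ A ∨ x = l + 1)) :
    dentedTrapezoid y₀ H m l A B \ {⟨l + 1, y₀, true⟩, ⟨l, y₀, false⟩} =
      dentedTrapezoid y₀ H m (l + 1) A' B := by
  ext ⟨x, y, u⟩
  cases u <;> simp [dentedTrapezoid] <;> grind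

/-- The dent at `l` settles, becoming a dent of the next row at the same abscissa. -/
theorem dentedTrapezoid_diff_above (hl : l ∈ A) (hA : ∀ x, l < x → (x ∈ A' ↔ x ∈ A))
    (hB : ∀ x, x ∈ B' ↔ x ∈ B ∨ x = l) :
    dentedTrapezoid y₀ H m l A B \ {⟨l, y₀ + 1, true⟩, ⟨l, y₀, false⟩} =
      dentedTrapezoid y₀ H m (l + 1) A' B' := by
  ext ⟨x, y, u⟩
  cases u <;> simp [dentedTrapezoid] <;> grind

theorem dentedTrapezoid_last (hl : l ∈ A) (hm : l + y₀ + 1 = m) :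
    dentedTrapezoid y₀ H m l A B = dentedTrapezoid (y₀ + 1) H m 0 B ∅ := by
  ext ⟨x, y, u⟩
  cases u <;> simp [dentedTrapezoid] <;> grind

end regions

/-! ### The determinant for dented trapezoids -/

/-- The matrix of binomial coefficients `(c i).choose j`, in which the rows with `i < s` are replaced
by their forward differences. -/
def dentMatrix {h : ℕ} (c : Fin h → ℕ) (s : ℕ) : Matrix (Fin h) (Fin h) ℤ :=
  Matrix.of fun i j => if i < s then ((c i + 1).choose j : ℤ) - (c i).choose j else (c i).choose j

/-- Linearity in row `s`. This mirrors the two choices at a dent: it moves right (`c s` increases by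
one) or settles (`s` increases by one). -/
theorem det_dentMatrix_succ {h : ℕ} (c : Fin h → ℕ) (s : Fin h) :
    (dentMatrix c (s + 1)).det =
      (dentMatrix (Function.update c s (c s + 1)) s).det - (dentMatrix c s).det := by
  have h1 : dentMatrix c (s + 1) = (dentMatrix c s).updateRow s
      ((fun j : Fin h => ((c s + 1).choose j : ℤ)) + (-1 : ℤ) • fun j : Fin h => ((c s).choose j : ℤ)) := by
    ext i j
    rcases eq_or_ne i s with rfl | hi
    · simp [dentMatrix, sub_eq_add_neg]
    · have : (i : ℕ) < s + 1 ↔ (i : ℕ) < s := by have := Fin.val_ne_of_ne hi; omega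
      simp only [dentMatrix, Matrix.of_apply, this, Matrix.updateRow_ne hi]
  have h2 : dentMatrix (Function.update c s (c s + 1)) s =
      (dentMatrix c s).updateRow s (fun j : Fin h => ((c s + 1).choose j : ℤ)) := by
    ext i j
    rcases eq_or_ne i s with rfl | hi
    · simp [dentMatrix]
    · simp [dentMatrix, hi]
  have h3 : dentMatrix c s = (dentMatrix c s).updateRow s (fun j => ((c s).choose j : ℤ)) := by
    ext i j
    rcases eq_or_ne i s with rfl | hi
    · simp [dentMatrix]
    · simp [hi]
  rw [h1, h2, Matrix.det_updateRow_add, Matrix.det_updateRow_smul, ← h3]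
  ring

/-- Column `0` of the binomial matrix is constantly `1`, so its differences vanish. -/
theorem det_dentMatrix_self {h : ℕ} (c : Fin (h + 1) → ℕ) : (dentMatrix c (h + 1)).det = 0 :=
  Matrix.det_eq_zero_of_column_eq_zero 0 fun i => by
    simp [dentMatrix, Fin.is_le i]

/-- Only the last entry of column `0` survives. By Pascal's rule the differences in the remaining
columns are binomial coefficients with the lower index reduced by one, and the cofactor sign cancels
`(-1) ^ h`. -/
theorem det_dentMatrix_last {h : ℕ} (c : Fin (h + 1) → ℕ) :
    (-1) ^ h * (dentMatrix c h).det = (dentMatrix (fun i => c (Fin.castSucc i)) 0).det := by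
  rw [Matrix.det_succ_column_zero, Fin.sum_univ_castSucc]
  have : ∀ i : Fin h, dentMatrix c h i.castSucc 0 = 0 := fun i => by simp [dentMatrix]
  simp only [this, mul_zero, zero_mul, Finset.sum_const_zero, zero_add, Fin.val_last]
  have h1 : dentMatrix c h (Fin.last h) 0 = 1 := by simp [dentMatrix]
  rw [h1, mul_one, ← mul_assoc, ← mul_pow]
  simp only [one_mul, one_pow, mul_neg, neg_neg, mul_one]
  congr 1
  ext i j
  simp [dentMatrix, Nat.choose_succ_succ]

-- The bottom row is scanned from left to right, with `l` the current position and `d` the number of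
-- positions after it. The dents with index below `s` have settled in the next row, and the others
-- are still in the bottom row at or beyond `l`. Tilings and signed determinants obey the same
-- recursion.
open Classical in
theorem cast_numLozengeTilings_dentedTrapezoid_step {h : ℕ} {y₀ m : ℕ}
    (ih : ∀ c : Fin h → ℕ, StrictMono c → (∀ i, c i + (y₀ + 1) < m) →
      (numLozengeTilings (dentedTrapezoid (y₀ + 1) (y₀ + 1 + h) m 0 {x | ∃ i, (c i : ℤ) = x} ∅) : ℤ) =
        (dentMatrix c 0).det) (d : ℕ) :
    ∀ (l s : ℕ) (c : Fin (h + 1) → ℕ), StrictMono c → (∀ i, c i + y₀ < m) → l + y₀ + 1 + d = m →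
      s ≤ h + 1 → (∀ i : Fin (h + 1), (i : ℕ) < s → c i < l) →
      (∀ i : Fin (h + 1), s ≤ (i : ℕ) → l ≤ c i) →
      (numLozengeTilings (dentedTrapezoid y₀ (y₀ + 1 + h) m l 
        {x | ∃ i : Fin (h + 1), s ≤ (i : ℕ) ∧ (c i : ℤ) = x}
        {x | ∃ i : Fin (h + 1), (i : ℕ) < s ∧ (c i : ℤ) = x}) : ℤ) = (-1) ^ s * (dentMatrix c s).det := by
  induction d with
  | zero =>
    intro l s c hc hm hl hs hlt hge
    by_cases hsh : s = h + 1
    · subst hsh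
      -- All dents have settled, so the last upward triangle of the row has no neighbour left in the
      -- region.
      rw [det_dentMatrix_self, mul_zero, Nat.cast_eq_zero]
      refine numLozengeTilings_eq_zero (t := ⟨l, y₀, true⟩) ?_ ?_
      · simp [dentedTrapezoid]
        refine ⟨by omega, fun x hx => ?_⟩
        have := x.2
        omega
      · intro u hu hau
        rw [adj_up_iff] at hau
        rcases hau with rfl | rfl | rfl <;> simp [dentedTrapezoid] at hu; omega
    -- Two unsettled dents would need two positions, but only `l` is left; hence exactly one remains
    -- and it is at `l`.
    · have hs' : s = h := by
        by_contra hne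
        have h1 := hge ⟨h, by omega⟩ (by simp; omega)
        have h2 := hge ⟨s, by omega⟩ (by simp)
        have h3 : c ⟨s, by omega⟩ < c ⟨h, by omega⟩ := hc (by simp [Fin.lt_def]; omega)
        have h4 := hm ⟨h, by omega⟩
        omega
      subst hs'
      have hcl : c (Fin.last s) = l := by
        have h1 := hge (Fin.last s) (by simp)
        have h2 := hm (Fin.last s)
        omega
      rw [det_dentMatrix_last, ← ih (fun i => c i.castSucc) (hc.comp Fin.strictMono_castSucc),
        dentedTrapezoid_last]
      · congr 3
        ext x
        constructor
        · rintro ⟨i, hi, rfl⟩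
          exact ⟨⟨i, hi⟩, rfl⟩
        · rintro ⟨i, rfl⟩
          exact ⟨i.castSucc, by simp, rfl⟩
      · exact ⟨Fin.last s, by simp, by simp [hcl]⟩
      · omega
      · intro i
        have h1 := hlt i.castSucc (by simp)
        omega
  | succ d ihd =>
    intro l s c hc hm hl hs hlt hge
    -- At a dent, the downward triangle at `l` has lost its left neighbour and can be matched to the
    -- right or above.
    by_cases hex : ∃ h' : s < h + 1, c ⟨s, h'⟩ = l
    · obtain ⟨hsh, hcs⟩ := hex
      set c' := Function.update c ⟨s, hsh⟩ (l + 1) with hc'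
      have hc'ne : ∀ i : Fin (h + 1), (i : ℕ) ≠ s → c' i = c i := fun i hi =>
        Function.update_of_ne (by rintro rfl; exact hi rfl) _ _
      have hc's : c' ⟨s, hsh⟩ = l + 1 := Function.update_self _ _ _
      have hdet := det_dentMatrix_succ c ⟨s, hsh⟩
      rw [hcs, ← hc'] at hdet
      have hgt : ∀ i : Fin (h + 1), s < (i : ℕ) → l < c i := fun i hi =>
        hcs ▸ hc (show (⟨s, hsh⟩ : Fin (h + 1)) < i from hi)
      have hlA : (l : ℤ) ∈ {x : ℤ | ∃ i : Fin (h + 1), s ≤ (i : ℕ) ∧ (c i : ℤ) = x} :=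
        ⟨⟨s, hsh⟩, le_refl _, by rw [hcs]⟩
      rw [numLozengeTilings_eq_ite_add_ite (finite_dentedTrapezoid _ _ _ _ _ _)
        (t := ⟨l, y₀, false⟩) (s := ⟨l + 1, y₀, true⟩) (s' := ⟨l, y₀ + 1, true⟩) ?_
        ((adj_down_iff _ _ _).2 (by simp)) ((adj_down_iff _ _ _).2 (by simp)) (by simp) ?_]
      rotate_left
      · simp [dentedTrapezoid]
        omega
      · intro u hu hau
        rw [adj_down_iff] at hau
        rcases hau with rfl | h1 | h1
        · exact absurd hlA (hu.2.2.1 rfl rfl)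
        · exact Or.inl h1
        · exact Or.inr h1
      have hfirst : ((if (⟨l + 1, y₀, true⟩ : UnitTriangle) ∈
          dentedTrapezoid y₀ (y₀ + 1 + h) m l
            {x | ∃ i : Fin (h + 1), s ≤ (i : ℕ) ∧ (c i : ℤ) = x}
            {x | ∃ i : Fin (h + 1), (i : ℕ) < s ∧ (c i : ℤ) = x}
          then numLozengeTilings (dentedTrapezoid y₀ (y₀ + 1 + h) m l
            {x | ∃ i : Fin (h + 1), s ≤ (i : ℕ) ∧ (c i : ℤ) = x}
            {x | ∃ i : Fin (h + 1), (i : ℕ) < s ∧ (c i : ℤ) = x} \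
              {⟨l + 1, y₀, true⟩, ⟨l, y₀, false⟩}) else 0 : ℕ) : ℤ) =
          (-1) ^ s * (dentMatrix c' s).det := by
        by_cases hmem : ∃ i : Fin (h + 1), c i = l + 1
        · obtain ⟨i, hi⟩ := hmem
          have his : s < (i : ℕ) := by
            rcases lt_trichotomy (i : ℕ) s with h1 | h1 | h1
            · have := hlt i h1; omega
            · obtain rfl : i = ⟨s, hsh⟩ := Fin.ext h1
              omega
            · exact h1
          -- If `l + 1` is already a dent, the move to the right is impossible; correspondingly two
          -- rows of the matrix coincide.
          rw [if_neg, Matrix.det_zero_of_row_eq (i := ⟨s, hsh⟩) (j := i)]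
          · simp
          · rintro rfl; simp at his
          · ext j
            have h1 : ¬ (i : ℕ) < s := by omega
            simp [dentMatrix, hc's, h1, hc'ne i his.ne', hi]
          · intro h1
            exact h1.2.2.1 rfl rfl ⟨i, his.le, by rw [hi]; push_cast; ring⟩
        · push Not at hmem
          rw [if_pos, dentedTrapezoid_diff_right (A' := {x : ℤ | ∃ i : Fin (h + 1), s ≤ (i : ℕ) ∧ (c' i : ℤ) = x}) hlA]
          · have := ihd (l + 1) s c' ?_ ?_ (by omega) hs ?_ ?_
            · rw [← this]
              push_cast
              congr 3
              ext x
              exact exists_congr fun i => and_congr_right fun hi => by rw [hc'ne i hi.ne]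
            · intro i j hij
              have hij' : (i : ℕ) < j := hij
              have h1 := hc hij
              by_cases hi : (i : ℕ) = s
              · rw [hc'ne j (by omega), show i = ⟨s, hsh⟩ from Fin.ext hi, hc's]
                have := hmem j
                have := hgt j (by omega)
                omega
              · rw [hc'ne i hi]
                by_cases hj : (j : ℕ) = s
                · rw [show j = ⟨s, hsh⟩ from Fin.ext hj, hc's]
                  have := hlt i (by omega)
                  omega
                · rwa [hc'ne j hj]
            · intro i
              by_cases hi : (i : ℕ) = s
              · rw [show i = ⟨s, hsh⟩ from Fin.ext hi, hc's]
                omega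
              · rw [hc'ne i hi]
                exact hm i
            · intro i hi
              rw [hc'ne i hi.ne]
              have := hlt i hi
              omega
            · intro i hi
              by_cases hi' : (i : ℕ) = s
              · rw [show i = ⟨s, hsh⟩ from Fin.ext hi', hc's]
              · rw [hc'ne i hi']
                exact hgt i (by omega)
          · intro x hx
            constructor
            · rintro ⟨i, hi, rfl⟩
              by_cases hi' : (i : ℕ) = s
              · right
                rw [show i = ⟨s, hsh⟩ from Fin.ext hi', hc's]
                push_cast; ring
              · left
                exact ⟨i, hi, by rw [hc'ne i hi']⟩
            · rintro (⟨i, hi, rfl⟩ | rfl)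
              · refine ⟨i, hi, ?_⟩
                rw [hc'ne i]
                rintro h1
                rw [show i = ⟨s, hsh⟩ from Fin.ext h1, hcs] at hx
                exact lt_irrefl _ hx
              · exact ⟨⟨s, hsh⟩, le_refl _, by rw [hc's]; push_cast; ring⟩
          · refine ⟨⟨by simp, by simp; omega, by simp; omega, by simp; omega, by simp⟩,
              fun _ => by simp, ?_, fun _ h1 => by simp at h1⟩
            rintro - - ⟨i, -, hi⟩
            exact hmem i (by simp at hi; omega)
      have hsecond : ((if (⟨l, y₀ + 1, true⟩ : UnitTriangle) ∈
          dentedTrapezoid y₀ (y₀ + 1 + h) m l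
            {x | ∃ i : Fin (h + 1), s ≤ (i : ℕ) ∧ (c i : ℤ) = x}
            {x | ∃ i : Fin (h + 1), (i : ℕ) < s ∧ (c i : ℤ) = x}
          then numLozengeTilings (dentedTrapezoid y₀ (y₀ + 1 + h) m l
            {x | ∃ i : Fin (h + 1), s ≤ (i : ℕ) ∧ (c i : ℤ) = x}
            {x | ∃ i : Fin (h + 1), (i : ℕ) < s ∧ (c i : ℤ) = x} \
              {⟨l, y₀ + 1, true⟩, ⟨l, y₀, false⟩}) else 0 : ℕ) : ℤ) =
          (-1) ^ (s + 1) * (dentMatrix c (s + 1)).det := by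
        -- A trapezoid of height one has no next row in which a dent could settle.
        by_cases hh : h = 0
        · subst hh
          obtain rfl : s = 0 := by omega
          rw [if_neg]
          · have := det_dentMatrix_self c
            rw [this]
            simp
          · rintro ⟨⟨-, h1, -⟩, -⟩
            simp at h1
        · rw [if_pos, dentedTrapezoid_diff_above
            (A' := {x : ℤ | ∃ i : Fin (h + 1), s + 1 ≤ (i : ℕ) ∧ (c i : ℤ) = x})
            (B' := {x : ℤ | ∃ i : Fin (h + 1), (i : ℕ) < s + 1 ∧ (c i : ℤ) = x}) hlA]
          · have := ihd (l + 1) (s + 1) c hc hm (by omega) (by omega) ?_ ?_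
            · rw [← this]
              push_cast
              rfl
            · intro i hi
              by_cases hi' : (i : ℕ) = s
              · rw [show i = ⟨s, hsh⟩ from Fin.ext hi', hcs]
                omega
              · have := hlt i (by omega)
                omega
            · intro i hi
              exact hgt i (by omega)
          · intro x hx
            refine exists_congr fun i => ⟨fun hi => ⟨by omega, hi.2⟩, ?_⟩
            rintro ⟨hi, rfl⟩
            refine ⟨?_, rfl⟩
            by_contra h1
            rw [show i = ⟨s, hsh⟩ from Fin.ext (by simp; omega), hcs] at hx
            exact lt_irrefl _ hx
          · intro x
            constructor
            · rintro ⟨i, hi, rfl⟩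
              by_cases hi' : (i : ℕ) = s
              · right
                rw [show i = ⟨s, hsh⟩ from Fin.ext hi', hcs]
              · left
                exact ⟨i, by omega, rfl⟩
            · rintro (⟨i, hi, rfl⟩ | rfl)
              · exact ⟨i, by omega, rfl⟩
              · exact ⟨⟨s, hsh⟩, by simp, by rw [hcs]⟩
          · refine ⟨⟨by simp, by simp; omega, by simp, by simp; omega, by simp⟩,
              fun h1 => by simp at h1, fun _ h1 => by simp at h1, ?_⟩
            rintro - - ⟨i, hi, hi2⟩
            have := hlt i hi
            simp at hi2
            omega
      rw [Nat.cast_add]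
      refine (congrArg₂ (· + ·) hfirst hsecond).trans ?_
      simp only [] at hdet
      rw [hdet, pow_succ]
      ring
    · have hnot : ∀ i : Fin (h + 1), c i ≠ l := by
        intro i hi
        have hsi : s ≤ (i : ℕ) := by
          by_contra h1
          have := hlt i (by omega)
          omega
        have h1 := hge ⟨s, by omega⟩ (le_refl _)
        rcases hsi.eq_or_lt with h2 | h2
        · exact hex ⟨by omega, by rw [← hi]; congr 1; exact Fin.ext h2⟩
        · have : c ⟨s, by omega⟩ < c i := hc h2
          omega
      -- Away from a dent, the upward triangle at `l` can only be matched to its right, as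
      -- everything to its left is gone.
      rw [numLozengeTilings_eq_of_forced (t := ⟨l, y₀, true⟩) (s := ⟨l, y₀, false⟩) ?_ ?_
        ((adj_up_iff _ _ _).2 (by simp)) ?_, dentedTrapezoid_diff_pair]
      · have := ihd (l + 1) s c hc hm (by omega) hs (fun i hi => by have := hlt i hi; omega)
          (fun i hi => by have := hge i hi; have := hnot i; omega)
        rw [← this]
        push_cast
        rfl
      · refine ⟨⟨by simp, by simp; omega, by simp, by simp; omega, by simp⟩,
          fun _ => by simp, ?_, fun _ h1 => by simp at h1⟩
        rintro - - ⟨i, -, hi⟩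
        exact hnot i (by simpa using hi)
      · simp [dentedTrapezoid]
        omega
      · intro u hu hau
        rw [adj_up_iff] at hau
        rcases hau with h1 | rfl | rfl
        · exact h1
        · simp [dentedTrapezoid] at hu
        · simp [dentedTrapezoid] at hu

theorem cast_numLozengeTilings_dentedTrapezoid (h : ℕ) : ∀ (y₀ m : ℕ) (c : Fin h → ℕ),
    StrictMono c → (∀ i, c i + y₀ < m) →
      (numLozengeTilings (dentedTrapezoid y₀ (y₀ + h) m 0 {x | ∃ i, (c i : ℤ) = x} ∅) : ℤ) =
        (Matrix.of fun i j : Fin h => ((c i).choose j : ℤ)).det := by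
  suffices h : ∀ (y₀ m : ℕ) (c : Fin h → ℕ), StrictMono c → (∀ i, c i + y₀ < m) →
      (numLozengeTilings (dentedTrapezoid y₀ (y₀ + h) m 0 {x | ∃ i, (c i : ℤ) = x} ∅) : ℤ) =
        (dentMatrix c 0).det by
    simpa [dentMatrix] using h
  induction h with
  | zero =>
    intro y₀ m c hc hm
    have : dentedTrapezoid y₀ (y₀ + (0 : ℕ)) m 0 {x | ∃ i, (c i : ℤ) = x} ∅ = ∅ := by
      rw [Set.eq_empty_iff_forall_notMem]
      rintro t ⟨⟨h1, h2, -⟩, -⟩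
      simp at h2
      omega
    rw [this, numLozengeTilings_empty]
    simp
  | succ h ih =>
    intro y₀ m c hc hm
    have hm0 := hm 0
    have := cast_numLozengeTilings_dentedTrapezoid_step (h := h) (y₀ := y₀) (m := m)
      (by intro c' h1 h2; simpa using ih (y₀ + 1) m c' h1 h2) (m - y₀ - 1) 0 0 c hc hm (by omega)
      (by omega) (by simp) (by simp)
    simpa [add_assoc, add_comm (1 : ℤ)] using this

/-! ### Cutting a region in two -/

section cut

variable {U V : Set UnitTriangle} {D : Finset ℕ} {u v : ℕ → UnitTriangle}

/-- The only possible crossing lozenges are `{u x, v x}` with `x ∈ D`. Once those with `x ∈ A` are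
fixed as the ones present, every other lozenge lies on one side and avoids the triangles already
covered. -/
theorem isLozengeTiling_union_iff (hUV : Disjoint U V) (hu : ∀ x ∈ D, u x ∈ U)
    (hv : ∀ x ∈ D, v x ∈ V) (huv : ∀ x, Adj (u x) (v x))
    (hui : Function.Injective u) (hvi : Function.Injective v)
    (hadj : ∀ s ∈ U, ∀ t ∈ V, Adj s t → ∃ x ∈ D, s = u x ∧ t = v x)
    {A : Finset ℕ} (hA : A ⊆ D) (T : Set (Set UnitTriangle)) :
    (IsLozengeTiling (U ∪ V) T ∧ ∀ x ∈ D, ({u x, v x} : Set UnitTriangle) ∈ T ↔ x ∈ A) ↔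
      ∃ T₁ T₂, IsLozengeTiling (U \ u '' A) T₁ ∧ IsLozengeTiling (V \ v '' A) T₂ ∧
        T₁ ∪ T₂ ∪ (fun x => {u x, v x}) '' (A : Set ℕ) = T := by
  have hUV' : ∀ t, t ∈ U → t ∉ V := fun t h1 h2 => Set.disjoint_left.1 hUV h1 h2
  constructor
  · rintro ⟨hT, hTA⟩
    have key : ∀ L ∈ T, L ⊆ U \ u '' A ∨ L ⊆ V \ v '' A ∨
        ∃ x ∈ A, L = {u x, v x} := by
      intro L hL
      by_cases hex : ∃ x ∈ A, L = {u x, v x}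
      · exact Or.inr (Or.inr hex)
      have hno : ∀ x ∈ A, u x ∉ L ∧ v x ∉ L := by
        intro x hx
        have hxT := (hTA x (hA hx)).2 hx
        constructor
        · intro h
          exact hex ⟨x, hx, hT.eq_of_mem hL hxT h (by simp)⟩
        · intro h
          exact hex ⟨x, hx, hT.eq_of_mem hL hxT h (by simp)⟩
      have hcr : ∀ s t, Adj s t → L = {s, t} → s ∈ U → t ∈ V → False := by
        intro s t hst hLst hs ht
        obtain ⟨x, hx, rfl, rfl⟩ := hadj s hs t ht hst
        exact hex ⟨x, (hTA x hx).1 (hLst ▸ hL), hLst⟩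
      have hLUV := (hT.1 L hL).2
      obtain ⟨s, t, hst, hLst⟩ := (isLozenge_iff L).1 (hT.1 L hL).1
      have hs : s ∈ L := by rw [hLst]; simp
      have ht : t ∈ L := by rw [hLst]; simp
      rcases hLUV hs with hsU | hsV
      · rcases hLUV ht with htU | htV
        · left
          intro r hr
          refine ⟨?_, ?_⟩
          · rw [hLst] at hr
            rcases hr with rfl | rfl <;> assumption
          · rintro ⟨x, hx, rfl⟩
            exact (hno x hx).1 hr
        · exact (hcr s t hst hLst hsU htV).elim
      · rcases hLUV ht with htU | htV
        · exact (hcr t s hst.symm (by rw [hLst, Set.pair_comm]) htU hsV).elim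
        · right; left
          intro r hr
          refine ⟨?_, ?_⟩
          · rw [hLst] at hr
            rcases hr with rfl | rfl <;> assumption
          · rintro ⟨x, hx, rfl⟩
            exact (hno x hx).2 hr
    refine ⟨{L | L ∈ T ∧ L ⊆ U \ u '' A}, {L | L ∈ T ∧ L ⊆ V \ v '' A}, ?_, ?_, ?_⟩
    · refine ⟨fun L hL => ⟨(hT.1 L hL.1).1, hL.2⟩, fun t ht => ?_⟩
      obtain ⟨L, ⟨hL, htL⟩, huniq⟩ := hT.2 t (Or.inl ht.1)
      refine ⟨L, ⟨⟨hL, ?_⟩, htL⟩, fun M hM => huniq M ⟨hM.1.1, hM.2⟩⟩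
      rcases key L hL with h | h | ⟨x, hx, rfl⟩
      · exact h
      · exact absurd (h htL).1 (hUV' t ht.1)
      · rcases htL with rfl | rfl
        · exact absurd ⟨x, hx, rfl⟩ ht.2
        · exact absurd (hv x (hA hx)) (hUV' _ ht.1)
    · refine ⟨fun L hL => ⟨(hT.1 L hL.1).1, hL.2⟩, fun t ht => ?_⟩
      obtain ⟨L, ⟨hL, htL⟩, huniq⟩ := hT.2 t (Or.inr ht.1)
      refine ⟨L, ⟨⟨hL, ?_⟩, htL⟩, fun M hM => huniq M ⟨hM.1.1, hM.2⟩⟩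
      rcases key L hL with h | h | ⟨x, hx, rfl⟩
      · exact absurd ht.1 (hUV' t (h htL).1)
      · exact h
      · rcases htL with rfl | rfl
        · exact absurd ht.1 (hUV' _ (hu x (hA hx)))
        · exact absurd ⟨x, hx, rfl⟩ ht.2
    · ext L
      constructor
      · rintro ((h | h) | ⟨x, hx, rfl⟩)
        · exact h.1
        · exact h.1
        · exact (hTA x (hA hx)).2 hx
      · intro hL
        rcases key L hL with h | h | ⟨x, hx, rfl⟩
        · exact Or.inl (Or.inl ⟨hL, h⟩)
        · exact Or.inl (Or.inr ⟨hL, h⟩)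
        · exact Or.inr ⟨x, hx, rfl⟩
  · rintro ⟨T₁, T₂, h₁, h₂, rfl⟩
    refine ⟨⟨?_, ?_⟩, ?_⟩
    · rintro L ((h | h) | ⟨x, hx, rfl⟩)
      · exact ⟨(h₁.1 L h).1, fun t ht => Or.inl ((h₁.1 L h).2 ht).1⟩
      · exact ⟨(h₂.1 L h).1, fun t ht => Or.inr ((h₂.1 L h).2 ht).1⟩
      · refine ⟨(isLozenge_iff _).2 ⟨_, _, huv x, rfl⟩, ?_⟩
        rintro t (rfl | rfl)
        · exact Or.inl (hu x (hA hx))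
        · exact Or.inr (hv x (hA hx))
    · rintro t (ht | ht)
      · by_cases htA : t ∈ u '' A
        · obtain ⟨x, hx, rfl⟩ := htA
          refine ⟨{u x, v x}, ⟨Or.inr ⟨x, hx, rfl⟩, by simp⟩, ?_⟩
          rintro M ⟨(h | h) | ⟨x', hx', rfl⟩, hM⟩
          · exact absurd ⟨x, hx, rfl⟩ ((h₁.1 M h).2 hM).2
          · exact absurd ((h₂.1 M h).2 hM).1 (hUV' _ ht)
          · rcases hM with hM | hM
            · rw [hui hM]
            · exact absurd (hM ▸ hv x' (hA hx')) (hUV' _ ht)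
        · obtain ⟨L, ⟨hL, htL⟩, huniq⟩ := h₁.2 t ⟨ht, htA⟩
          refine ⟨L, ⟨Or.inl (Or.inl hL), htL⟩, ?_⟩
          rintro M ⟨(h | h) | ⟨x', hx', rfl⟩, hM⟩
          · exact huniq M ⟨h, hM⟩
          · exact absurd ((h₂.1 M h).2 hM).1 (hUV' _ ht)
          · rcases hM with rfl | rfl
            · exact absurd ⟨x', hx', rfl⟩ htA
            · exact absurd (hv x' (hA hx')) (hUV' _ ht)
      · by_cases htA : t ∈ v '' A
        · obtain ⟨x, hx, rfl⟩ := htA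
          refine ⟨{u x, v x}, ⟨Or.inr ⟨x, hx, rfl⟩, by simp⟩, ?_⟩
          rintro M ⟨(h | h) | ⟨x', hx', rfl⟩, hM⟩
          · exact absurd ht (hUV' _ ((h₁.1 M h).2 hM).1)
          · exact absurd ⟨x, hx, rfl⟩ ((h₂.1 M h).2 hM).2
          · rcases hM with hM | hM
            · exact absurd ht (hUV' _ (hM ▸ hu x' (hA hx')))
            · rw [hvi hM]
        · obtain ⟨L, ⟨hL, htL⟩, huniq⟩ := h₂.2 t ⟨ht, htA⟩
          refine ⟨L, ⟨Or.inl (Or.inr hL), htL⟩, ?_⟩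
          rintro M ⟨(h | h) | ⟨x', hx', rfl⟩, hM⟩
          · exact absurd ht (hUV' _ ((h₁.1 M h).2 hM).1)
          · exact huniq M ⟨h, hM⟩
          · rcases hM with rfl | rfl
            · exact absurd ht (hUV' _ (hu x' (hA hx')))
            · exact absurd ⟨x', hx', rfl⟩ htA
    · intro x hx
      constructor
      · rintro ((h | h) | ⟨x', hx', h⟩)
        · exact absurd (hv x hx) (hUV' _ ((h₁.1 _ h).2 (by simp)).1)
        · exact absurd ((h₂.1 _ h).2 (by simp : u x ∈ _)).1 (hUV' _ (hu x hx))
        · have h1 : u x ∈ ({u x', v x'} : Set UnitTriangle) := by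
            have : u x ∈ ({u x, v x} : Set UnitTriangle) := by simp
            rwa [← h] at this
          rcases h1 with h1 | h1
          · rwa [hui h1]
          · exact absurd (h1 ▸ hv x' (hA hx')) (hUV' _ (hu x hx))
      · exact fun h => Or.inr ⟨x, h, rfl⟩

open Classical in
/-- Classification of the tilings of a region that is cut into two parts by the set of lozenges that
meet both parts. -/
theorem numLozengeTilings_union (hU : U.Finite) (hV : V.Finite) (hUV : Disjoint U V)
    (hu : ∀ x ∈ D, u x ∈ U) (hv : ∀ x ∈ D, v x ∈ V) (huv : ∀ x, Adj (u x) (v x))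
    (hui : Function.Injective u) (hvi : Function.Injective v)
    (hadj : ∀ s ∈ U, ∀ t ∈ V, Adj s t → ∃ x ∈ D, s = u x ∧ t = v x) :
    numLozengeTilings (U ∪ V) =
      ∑ A ∈ D.powerset, numLozengeTilings (U \ u '' A) * numLozengeTilings (V \ v '' A) := by
  have hfin := finite_setOf_isLozengeTiling (hU.union hV)
  rw [numLozengeTilings, Set.ncard_eq_toFinset_card _ hfin,
    Finset.card_eq_sum_card_fiberwise (t := D.powerset)
      (f := fun T => D.filter fun x => ({u x, v x} : Set UnitTriangle) ∈ T)
      (fun T _ => Finset.mem_powerset.2 (Finset.filter_subset _ _))]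
  refine Finset.sum_congr rfl fun A hA => ?_
  rw [Finset.mem_powerset] at hA
  rw [numLozengeTilings, numLozengeTilings, ← Set.ncard_prod, ← Set.ncard_coe_finset]
  have himg : ((hfin.toFinset.filter fun T =>
      (D.filter fun x => ({u x, v x} : Set UnitTriangle) ∈ T) = A : Finset _) : Set _) =
      (fun p : Set (Set UnitTriangle) × Set (Set UnitTriangle) =>
        p.1 ∪ p.2 ∪ (fun x => {u x, v x}) '' (A : Set ℕ)) ''
      ({T | IsLozengeTiling (U \ u '' A) T} ×ˢ {T | IsLozengeTiling (V \ v '' A) T}) := by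
    ext T
    have hiff := isLozengeTiling_union_iff hUV hu hv huv hui hvi hadj hA T
    have h1 : (D.filter fun x => ({u x, v x} : Set UnitTriangle) ∈ T) = A ↔
        ∀ x ∈ D, ({u x, v x} : Set UnitTriangle) ∈ T ↔ x ∈ A := by
      rw [Finset.ext_iff]
      simp only [Finset.mem_filter]
      exact ⟨fun h x hx => by rw [← h x]; simp [hx],
        fun h x => ⟨fun hx => (h x hx.1).1 hx.2, fun hx => ⟨hA hx, (h x (hA hx)).2 hx⟩⟩⟩
    simp only [Finset.coe_filter, Set.Finite.mem_toFinset, Set.mem_ofPred_eq, h1, hiff,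
      Set.mem_image, Set.mem_prod, Prod.exists, and_assoc]
  rw [himg, Set.InjOn.ncard_image]
  rintro ⟨T₁, T₂⟩ ⟨h₁, h₂⟩ ⟨T₁', T₂'⟩ ⟨h₁', h₂'⟩ heq
  have hrec₁ : ∀ S₁ S₂, IsLozengeTiling (U \ u '' A) S₁ → IsLozengeTiling (V \ v '' A) S₂ →
      {L | L ∈ S₁ ∪ S₂ ∪ (fun x => {u x, v x}) '' (A : Set ℕ) ∧ L ⊆ U} = S₁ := by
    intro S₁ S₂ g₁ g₂
    ext L
    constructor
    · rintro ⟨(h | h) | ⟨x, hx, rfl⟩, hL⟩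
      · exact h
      · obtain ⟨t, ht⟩ := (g₂.1 L h).1.nonempty
        exact (Set.disjoint_left.1 hUV (hL ht) ((g₂.1 L h).2 ht).1).elim
      · exact (Set.disjoint_left.1 hUV (hL (by simp)) (hv x (hA hx))).elim
    · exact fun h => ⟨Or.inl (Or.inl h), fun t ht => ((g₁.1 L h).2 ht).1⟩
  have hrec₂ : ∀ S₁ S₂, IsLozengeTiling (U \ u '' A) S₁ → IsLozengeTiling (V \ v '' A) S₂ →
      {L | L ∈ S₁ ∪ S₂ ∪ (fun x => {u x, v x}) '' (A : Set ℕ) ∧ L ⊆ V} = S₂ := by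
    intro S₁ S₂ g₁ g₂
    ext L
    constructor
    · rintro ⟨(h | h) | ⟨x, hx, rfl⟩, hL⟩
      · obtain ⟨t, ht⟩ := (g₁.1 L h).1.nonempty
        exact (Set.disjoint_left.1 hUV ((g₁.1 L h).2 ht).1 (hL ht)).elim
      · exact h
      · exact (Set.disjoint_left.1 hUV (hu x (hA hx)) (hL (by simp))).elim
    · exact fun h => ⟨Or.inl (Or.inr h), fun t ht => ((g₂.1 L h).2 ht).1⟩
  simp only at heq
  rw [Prod.mk.injEq]
  refine ⟨?_, ?_⟩
  · rw [← hrec₁ T₁ T₂ h₁ h₂, heq, hrec₁ T₁' T₂' h₁' h₂']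
  · rw [← hrec₂ T₁ T₂ h₁ h₂, heq, hrec₂ T₁' T₂' h₁' h₂']

end cut

/-! ### Balance of upward and downward triangles -/

theorem IsLozengeTiling.exists_partner {R : Set UnitTriangle} {T : Set (Set UnitTriangle)}
    (hT : IsLozengeTiling R T) (b : Bool) :
    ∃ p : UnitTriangle → UnitTriangle, Set.InjOn p {t | t ∈ R ∧ t.up = b} ∧
      Set.MapsTo p {t | t ∈ R ∧ t.up = b} {t | t ∈ R ∧ t.up = !b} := by
  have : ∀ t, ∃ s, t ∈ R → ({t, s} : Set UnitTriangle) ∈ T ∧ Adj t s := by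
    intro t
    by_cases ht : t ∈ R
    · obtain ⟨L, ⟨hL, htL⟩, -⟩ := hT.2 t ht
      obtain ⟨s, hs, rfl⟩ := (hT.1 L hL).1.exists_adj htL
      exact ⟨s, fun _ => ⟨Set.pair_comm s t ▸ hL, hs⟩⟩
    · exact ⟨t, fun h => absurd h ht⟩
  choose p hp using this
  have hup : ∀ t ∈ R, (p t).up = !t.up := by
    rintro ⟨x, y, u⟩ ht
    have := (hp _ ht).2
    cases u
    · rw [adj_down_iff] at this
      rcases this with h | h | h <;> rw [h] <;> rfl
    · rw [adj_up_iff] at this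
      rcases this with h | h | h <;> rw [h] <;> rfl
  refine ⟨p, ?_, ?_⟩
  · rintro s ⟨hs, hsb⟩ t ⟨ht, htb⟩ hst
    have h1 := hT.eq_of_mem (hp s hs).1 (hp t ht).1 (t := p s) (by simp) (by simp [hst])
    have h2 : s ∈ ({t, p t} : Set UnitTriangle) := h1 ▸ (by simp)
    rcases h2 with h2 | h2
    · exact h2
    · have h3 := hup t ht
      rw [← h2, hsb, htb] at h3
      cases b <;> simp at h3
  · rintro t ⟨ht, htb⟩
    exact ⟨(hT.1 _ (hp t ht).1).2 (by simp), by rw [hup t ht, htb]⟩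

theorem IsLozengeTiling.ncard_up_eq {R : Set UnitTriangle} {T : Set (Set UnitTriangle)}
    (hR : R.Finite) (hT : IsLozengeTiling R T) :
    {t | t ∈ R ∧ t.up = true}.ncard = {t | t ∈ R ∧ t.up = false}.ncard := by
  obtain ⟨p, hp1, hp2⟩ := hT.exists_partner true
  obtain ⟨q, hq1, hq2⟩ := hT.exists_partner false
  exact le_antisymm (Set.ncard_le_ncard_of_injOn p hp2 hp1 (hR.subset fun _ h => h.1))
    (Set.ncard_le_ncard_of_injOn q hq2 hq1 (hR.subset fun _ h => h.1))

/-- Without dents, each of the `k` rows has one more upward than downward triangle, and a tiling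
needs equality. For `k = 0` there is no row to carry a dent, hence the condition `hk`. -/
theorem card_eq_of_isLozengeTiling_dentedTrapezoid {k m : ℕ} (hkm : k ≤ m) {A : Finset ℕ}
    (hA : ∀ x ∈ A, x < m) (hk : 0 < k ∨ A = ∅) {T : Set (Set UnitTriangle)}
    (hT : IsLozengeTiling (dentedTrapezoid 0 k m 0 {x : ℤ | ∃ a ∈ A, (a : ℤ) = x} ∅) T) :
    A.card = k := by
  have hfin := finite_dentedTrapezoid 0 k m 0 {x : ℤ | ∃ a ∈ A, (a : ℤ) = x} ∅
  have hbal := hT.ncard_up_eq hfin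
  set R := dentedTrapezoid 0 k m 0 {x : ℤ | ∃ a ∈ A, (a : ℤ) = x} ∅ with hR
  -- Both sides are the upward triangles of the undented trapezoid: on the right, those with `0 < x`
  -- are the shifted downward ones, and those with `x = 0` are one for each row.
  have h1 : {t | t ∈ R ∧ t.up = true} ∪ (fun a : ℕ => (⟨a, 0, true⟩ : UnitTriangle)) '' A =
      (fun t : UnitTriangle => (⟨t.x + 1, t.y, true⟩ : UnitTriangle)) '' {t | t ∈ R ∧ t.up = false} ∪
        (fun y : ℕ => (⟨0, y, true⟩ : UnitTriangle)) '' (Finset.range k) := by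
    ext ⟨x, y, u⟩
    constructor
    · rintro (⟨h1, h2⟩ | ⟨a, ha, h⟩)
      · simp only at h2
        subst h2
        obtain ⟨⟨g1, g2, g3, g4, -⟩, -⟩ := h1
        simp only at g1 g2 g3 g4
        by_cases hx : x = 0
        · subst hx
          exact Or.inr ⟨y.toNat, by simp; omega, by simp [g1]⟩
        · refine Or.inl ⟨⟨x - 1, y, false⟩, ⟨?_, rfl⟩, by simp⟩
          simp [hR, dentedTrapezoid]
          omega
      · simp only [mk.injEq] at h
        obtain ⟨rfl, rfl, rfl⟩ := h
        have ha' := hA a ha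
        have hk' : 0 < k := hk.resolve_right (Finset.ne_empty_of_mem ha)
        by_cases hx : a = 0
        · subst hx
          exact Or.inr ⟨0, by simpa using hk', by simp⟩
        · refine Or.inl ⟨⟨a - 1, 0, false⟩, ⟨?_, rfl⟩, by simp⟩
          simp [hR, dentedTrapezoid]
          omega
    · have hmem : ∀ x y : ℤ, 0 ≤ y → y < k → 0 ≤ x → x + y < m →
          (⟨x, y, true⟩ : UnitTriangle) ∈ {t | t ∈ R ∧ t.up = true} ∪
            (fun a : ℕ => (⟨a, 0, true⟩ : UnitTriangle)) '' A := by
        intro x y g1 g2 g3 g4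
        by_cases hxA : y = 0 ∧ ∃ a ∈ A, (a : ℤ) = x
        · obtain ⟨rfl, a, ha, rfl⟩ := hxA
          exact Or.inr ⟨a, ha, rfl⟩
        · exact Or.inl ⟨⟨⟨g1, g2, g3, g4, by simp⟩, fun _ => g3, fun _ h h' => hxA ⟨h, h'⟩,
            fun _ _ => id⟩, rfl⟩
      rintro (⟨⟨x', y', u'⟩, ⟨h1, h2⟩, h⟩ | ⟨a, ha, h⟩)
      · simp only [mk.injEq] at h h2
        obtain ⟨rfl, rfl, rfl⟩ := h
        obtain ⟨⟨g1, g2, g3, g4, g5⟩, -⟩ := h1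
        simp only at g1 g2 g3 g4 g5
        exact hmem _ _ g1 g2 (by omega) (by have := g5 h2; omega)
      · simp only [mk.injEq] at h
        obtain ⟨rfl, rfl, rfl⟩ := h
        simp only [Finset.coe_range, Set.mem_Iio] at ha
        exact hmem _ _ (by omega) (by omega) le_rfl (by omega)
  have h2 := congrArg Set.ncard h1
  rw [Set.ncard_union_eq _ (hfin.subset fun _ h => h.1) (A.finite_toSet.image _),
    Set.ncard_union_eq _ ((hfin.subset fun _ h => h.1).image _)
      ((Finset.range k).finite_toSet.image _), Set.InjOn.ncard_image, Set.InjOn.ncard_image,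
    Set.InjOn.ncard_image, Set.ncard_coe_finset, Set.ncard_coe_finset, Finset.card_range] at h2
  · omega
  · intro a _ b _ h
    simpa using h
  · rintro ⟨x, y, u⟩ ⟨-, h⟩ ⟨x', y', u'⟩ ⟨-, h'⟩ hh
    simp at h h' hh
    simp [h, h', hh]
  · intro a _ b _ h
    simpa using h
  · rw [Set.disjoint_left]
    rintro _ ⟨⟨x, y, u⟩, ⟨h1, h2⟩, rfl⟩ ⟨z, hz, h⟩
    simp [hR, dentedTrapezoid] at h1 h
    omega
  · rw [Set.disjoint_left]
    rintro _ ⟨h1, h2⟩ ⟨a, ha, rfl⟩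
    exact h1.2.2.1 rfl rfl ⟨a, ha, rfl⟩

/-! ### Reflection and the two halves of the hexagon -/

namespace UnitTriangle

/-- The reflection in the horizontal line through the origin. -/
def reflect (t : UnitTriangle) : UnitTriangle :=
  if t.up then ⟨t.x + t.y, -t.y - 1, false⟩ else ⟨t.x + t.y + 1, -t.y - 1, true⟩

theorem reflect_reflect (t : UnitTriangle) : t.reflect.reflect = t := by
  obtain ⟨x, y, u⟩ := t
  cases u <;> simp [reflect]
  ring

theorem Adj.reflect {s t : UnitTriangle} (h : Adj s t) : Adj s.reflect t.reflect := by
  obtain ⟨x, y, u⟩ := s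
  cases u
  · rw [adj_down_iff] at h
    rcases h with rfl | rfl | rfl <;> simp [UnitTriangle.reflect, adj_up_iff] <;> omega
  · rw [adj_up_iff] at h
    rcases h with rfl | rfl | rfl <;> simp [UnitTriangle.reflect, adj_down_iff] <;> omega

theorem mem_image_reflect {R : Set UnitTriangle} {t : UnitTriangle} :
    t ∈ reflect '' R ↔ t.reflect ∈ R :=
  ⟨by rintro ⟨s, hs, rfl⟩; rwa [reflect_reflect], fun h => ⟨_, h, reflect_reflect t⟩⟩

theorem image_reflect_image_reflect (R : Set UnitTriangle) : reflect '' (reflect '' R) = R := by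
  ext t
  rw [mem_image_reflect, mem_image_reflect, reflect_reflect]

end UnitTriangle

theorem IsLozengeTiling.image_reflect {R : Set UnitTriangle} {T : Set (Set UnitTriangle)}
    (h : IsLozengeTiling R T) : IsLozengeTiling (reflect '' R) ((reflect '' ·) '' T) := by
  refine ⟨?_, fun t ht => ?_⟩
  · rintro _ ⟨L, hL, rfl⟩
    refine ⟨?_, Set.image_mono (h.1 L hL).2⟩
    obtain ⟨a, b, hab, rfl⟩ := (isLozenge_iff L).1 (h.1 L hL).1
    exact (isLozenge_iff _).2 ⟨_, _, hab.reflect, Set.image_pair _ _ _⟩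
  · rw [mem_image_reflect] at ht
    obtain ⟨L, ⟨hL, htL⟩, huniq⟩ := h.2 _ ht
    refine ⟨_, ⟨⟨L, hL, rfl⟩, mem_image_reflect.2 htL⟩, ?_⟩
    rintro _ ⟨⟨M, hM, rfl⟩, htM⟩
    rw [huniq M ⟨hM, mem_image_reflect.1 htM⟩]

theorem numLozengeTilings_image_reflect (R : Set UnitTriangle) :
    numLozengeTilings (reflect '' R) = numLozengeTilings R := by
  have hinv : ∀ T : Set (Set UnitTriangle), (reflect '' ·) '' ((reflect '' ·) '' T) = T := by
    intro T
    rw [Set.image_image]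
    simp only [image_reflect_image_reflect, Set.image_id']
  have himg : {T | IsLozengeTiling (reflect '' R) T} =
      (fun T : Set (Set UnitTriangle) => (reflect '' ·) '' T) '' {T | IsLozengeTiling R T} := by
    ext T
    constructor
    · intro hT
      refine ⟨(reflect '' ·) '' T, ?_, hinv T⟩
      have := hT.image_reflect
      rwa [image_reflect_image_reflect] at this
    · rintro ⟨T', hT', rfl⟩
      exact IsLozengeTiling.image_reflect hT'
  rw [numLozengeTilings, himg, Set.InjOn.ncard_image, numLozengeTilings]
  intro S _ T _ h
  rw [← hinv S, ← hinv T]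
  exact congrArg _ h

/-- The determinant of binomial coefficients that counts the lozenge tilings of a trapezoid with
dents at the elements of `A`. -/
def dentDet (A : Finset ℕ) : ℤ :=
  (Matrix.of fun i j : Fin A.card => ((A.orderEmbOfFin rfl i).choose j : ℤ)).det

theorem cast_numLozengeTilings_eq_dentDet {m : ℕ} {A : Finset ℕ} (hA : ∀ x ∈ A, x < m) :
    (numLozengeTilings (dentedTrapezoid 0 A.card m 0 {x : ℤ | ∃ a ∈ A, (a : ℤ) = x} ∅) : ℤ) =
      dentDet A := by
  have := cast_numLozengeTilings_dentedTrapezoid A.card 0 m (A.orderEmbOfFin rfl)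
    (A.orderEmbOfFin rfl).strictMono (fun i => hA _ (A.orderEmbOfFin_mem rfl i))
  rw [dentDet, ← this]
  congr 3
  · simp
  · ext x
    constructor
    · rintro ⟨a, ha, rfl⟩
      have : a ∈ Set.range (A.orderEmbOfFin rfl) := by rw [Finset.range_orderEmbOfFin]; exact ha
      obtain ⟨i, rfl⟩ := this
      exact ⟨i, rfl⟩
    · rintro ⟨i, rfl⟩
      exact ⟨_, A.orderEmbOfFin_mem rfl i, rfl⟩

theorem up_mem_hexagon_iff {n k : ℕ} (hk : k ≤ 2 * n) (x y : ℤ) :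
    (⟨x, y, true⟩ : UnitTriangle) ∈ hexagon k (2 * n + 1 - k) k (k + 1) (2 * n - k) (k + 1) ↔
      0 ≤ x ∧ y + 1 ≤ k ∧ x + y + 1 ≤ 2 * n + 1 ∧ x + 1 ≤ 2 * n + 1 ∧ -(k + 1) ≤ y ∧ 0 ≤ x + y := by
  simp only [hexagon, HexagonCloses, Set.mem_ofPred_eq, vertices, if_true, Finset.mem_insert,
    Finset.mem_singleton, forall_eq_or_imp, forall_eq, true_and]
  omega

theorem down_mem_hexagon_iff {n k : ℕ} (hk : k ≤ 2 * n) (x y : ℤ) :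
    (⟨x, y, false⟩ : UnitTriangle) ∈ hexagon k (2 * n + 1 - k) k (k + 1) (2 * n - k) (k + 1) ↔
      0 ≤ x ∧ y + 1 ≤ k ∧ x + y + 2 ≤ 2 * n + 1 ∧ x + 1 ≤ 2 * n + 1 ∧ -(k + 1) ≤ y ∧
        0 ≤ x + y + 1 := by
  simp only [hexagon, HexagonCloses, Set.mem_ofPred_eq, vertices, Bool.false_eq_true, if_false,
    Finset.mem_insert, Finset.mem_singleton, forall_eq_or_imp, forall_eq, true_and]
  omega

theorem upper_region_eq {n k : ℕ} (hk : k ≤ 2 * n) (A : Finset ℕ) :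
    {t | t ∈ hexagon k (2 * n + 1 - k) k (k + 1) (2 * n - k) (k + 1) \ {centralTriangle n} ∧
      0 ≤ t.y} \ (fun x : ℕ => (⟨x, 0, true⟩ : UnitTriangle)) '' A =
      dentedTrapezoid 0 k (2 * n + 1 : ℕ) 0 {x : ℤ | ∃ a ∈ A, (a : ℤ) = x} ∅ := by
  ext ⟨x, y, u⟩
  cases u
  · simp only [Set.mem_sdiff, Set.mem_ofPred_eq, down_mem_hexagon_iff hk, Set.mem_singleton_iff,
      centralTriangle, dentedTrapezoid, mk.injEq, Set.mem_image, Finset.mem_coe]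
    simp
    omega
  · simp only [Set.mem_sdiff, Set.mem_ofPred_eq, up_mem_hexagon_iff hk, Set.mem_singleton_iff,
      centralTriangle, dentedTrapezoid, mk.injEq, Set.mem_image, Finset.mem_coe]
    simp
    grind

/-- Reflection turns the central triangle into the upward triangle at `n` in the bottom row, that
is, an additional dent. -/
theorem lower_region_eq {n k : ℕ} (hk : k ≤ 2 * n) (A : Finset ℕ) :
    {t | t ∈ hexagon k (2 * n + 1 - k) k (k + 1) (2 * n - k) (k + 1) \ {centralTriangle n} ∧
      t.y < 0} \ (fun x : ℕ => (⟨x, -1, false⟩ : UnitTriangle)) '' A =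
      reflect '' dentedTrapezoid 0 (k + 1 : ℕ) (2 * n + 1 : ℕ) 0
        {x : ℤ | ∃ a ∈ insert n A, (a : ℤ) = x} ∅ := by
  ext ⟨x, y, u⟩
  rw [mem_image_reflect]
  cases u
  · simp only [Set.mem_sdiff, Set.mem_ofPred_eq, down_mem_hexagon_iff hk, Set.mem_singleton_iff,
      centralTriangle, dentedTrapezoid, mk.injEq, Set.mem_image, Finset.mem_coe, reflect]
    simp
    grind
  · simp only [Set.mem_sdiff, Set.mem_ofPred_eq, up_mem_hexagon_iff hk, Set.mem_singleton_iff,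
      centralTriangle, dentedTrapezoid, mk.injEq, Set.mem_image, Finset.mem_coe, reflect]
    simp
    omega

theorem numTilingsNoCenter_eq_sum {n k : ℕ} (hk : k ≤ 2 * n) :
    (numTilingsNoCenter n k : ℤ) = ∑ A ∈ Finset.powersetCard k ((Finset.range (2 * n + 1)).erase n),
      dentDet A * dentDet (insert n A) := by
  set R := hexagon k (2 * n + 1 - k) k (k + 1) (2 * n - k) (k + 1) \ {centralTriangle n} with hR
  set U : Set UnitTriangle := {t | t ∈ R ∧ 0 ≤ t.y} with hU
  set V : Set UnitTriangle := {t | t ∈ R ∧ t.y < 0} with hV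
  set E := (Finset.range (2 * n + 1)).erase n with hE
  -- For `k = 0` the upper half is empty and no lozenge can cross the cut.
  set D := if k = 0 then ∅ else E with hD
  have hDE : D ⊆ E := by rw [hD]; split_ifs <;> simp
  have hUA := upper_region_eq (n := n) (k := k) hk
  have hVA := lower_region_eq (n := n) (k := k) hk
  rw [← hR] at hUA hVA
  rw [← hU] at hUA
  rw [← hV] at hVA
  have hUV : R = U ∪ V := by
    ext t
    simp only [hU, hV, Set.mem_union, Set.mem_ofPred_eq, ← and_or_left]
    exact ⟨fun h => ⟨h, le_or_gt _ _⟩, fun h => h.1⟩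
  have hUf : U.Finite := by
    have := hUA ∅
    simp only [Finset.coe_empty, Set.image_empty, Set.sdiff_empty] at this
    rw [this]
    exact finite_dentedTrapezoid _ _ _ _ _ _
  have hVf : V.Finite := by
    have := hVA ∅
    simp only [Finset.coe_empty, Set.image_empty, Set.sdiff_empty] at this
    rw [this]
    exact (finite_dentedTrapezoid _ _ _ _ _ _).image _
  have hcut := numLozengeTilings_union (U := U) (V := V) (D := D)
    (u := fun x : ℕ => ⟨x, 0, true⟩) (v := fun x : ℕ => ⟨x, -1, false⟩) hUf hVf
    (by rw [Set.disjoint_left]; rintro t ⟨-, h1⟩ ⟨-, h2⟩; omega)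
    (by
      intro x hx
      have hx' := hDE hx
      have hk0 : k ≠ 0 := by rintro rfl; simp [hD] at hx
      simp [hE] at hx'
      simp [hU, hR, up_mem_hexagon_iff hk, centralTriangle]
      omega)
    (by
      intro x hx
      have hx' := hDE hx
      simp [hE] at hx'
      simp [hV, hR, down_mem_hexagon_iff hk, centralTriangle]
      omega)
    (by intro x; rw [adj_up_iff]; simp)
    (by intro x y h; simpa using h) (by intro x y h; simpa using h)
    (by
      rintro ⟨x, y, u⟩ ⟨hs, hs'⟩ t ⟨ht, ht'⟩ hst
      cases u
      · rw [adj_down_iff] at hst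
        exfalso
        rcases hst with rfl | rfl | rfl <;> simp at hs' ht' <;> omega
      · rw [adj_up_iff] at hst
        simp only at hs'
        rcases hst with rfl | rfl | rfl
        · simp at ht'; omega
        · simp at ht'; omega
        · simp only at ht'
          obtain rfl : y = 0 := by omega
          simp [hR, up_mem_hexagon_iff hk, down_mem_hexagon_iff hk, centralTriangle] at hs ht
          refine ⟨x.toNat, ?_, ?_⟩
          · rw [hD, if_neg (by omega), hE, Finset.mem_erase, Finset.mem_range]
            omega
          · simp
            omega)
  rw [numTilingsNoCenter, ← hR, hUV, hcut, Nat.cast_sum]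
  have hsub : Finset.powersetCard k D = Finset.powersetCard k E := by
    by_cases h0 : k = 0
    · subst h0; simp
    · rw [hD, if_neg h0]
  rw [← hsub]
  symm
  have hlt : ∀ A ∈ D.powerset, ∀ x ∈ A, x < 2 * n + 1 ∧ x ≠ n := by
    intro A hA x hx
    have := hDE (Finset.mem_powerset.1 hA hx)
    simp [hE] at this
    omega
  refine (Finset.sum_congr rfl fun A hA => ?_).trans
    (Finset.sum_subset (fun A hA => Finset.mem_powerset.2 (Finset.mem_powersetCard.1 hA).1) ?_)
  · obtain ⟨hAD, hAk⟩ := Finset.mem_powersetCard.1 hA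
    have hA' := hlt A (Finset.mem_powerset.2 hAD)
    have hnA : n ∉ A := fun h => (hA' n h).2 rfl
    have hcard : (insert n A).card = k + 1 := by rw [Finset.card_insert_of_notMem hnA, hAk]
    have h1 := cast_numLozengeTilings_eq_dentDet (m := 2 * n + 1) fun x hx => (hA' x hx).1
    have h2 := cast_numLozengeTilings_eq_dentDet (m := 2 * n + 1) (A := insert n A) (by
      intro x hx
      rcases Finset.mem_insert.1 hx with rfl | hx
      · omega
      · exact (hA' x hx).1)
    rw [hcard] at h2
    rw [hAk] at h1
    rw [hUA, hVA, numLozengeTilings_image_reflect, Nat.cast_mul, h1, h2]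
  -- If `A` does not have `k` elements, the upper half has no tiling.
  · intro A hA hAk
    have hA' := hlt A hA
    rw [hUA, Nat.cast_eq_zero]
    refine mul_eq_zero_of_left ?_ _
    rw [numLozengeTilings]
    refine (congrArg Set.ncard ?_).trans (Set.ncard_empty _)
    rw [Set.eq_empty_iff_forall_notMem]
    intro T hT
    refine hAk (Finset.mem_powersetCard.2 ⟨Finset.mem_powerset.1 hA,
      card_eq_of_isLozengeTiling_dentedTrapezoid (by omega) (fun x hx => (hA' x hx).1) ?_ hT⟩)
    rw [Finset.mem_powerset, hD] at hA
    split_ifs at hA with h0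
    · exact Or.inr (Finset.subset_empty.1 hA)
    · exact Or.inl (by omega)

/-! ### Vandermonde products and Cauchy–Binet -/

/-- The increasing enumeration of a set of `k` natural numbers. -/
noncomputable def enum (k : ℕ) (A : Finset ℕ) : Fin k → ℕ :=
  if h : A.card = k then A.orderEmbOfFin h else 0

theorem enum_injective {k : ℕ} {A : Finset ℕ} (h : A.card = k) : Function.Injective (enum k A) := by
  rw [enum, dif_pos h]
  exact (A.orderEmbOfFin h).injective

theorem strictMono_enum {k : ℕ} {A : Finset ℕ} (h : A.card = k) : StrictMono (enum k A) := by
  rw [enum, dif_pos h]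
  exact (A.orderEmbOfFin h).strictMono

theorem image_enum {k : ℕ} {A : Finset ℕ} (h : A.card = k) : Finset.univ.image (enum k A) = A := by
  rw [enum, dif_pos h]
  exact A.image_orderEmbOfFin_univ h

theorem range_enum {k : ℕ} {A : Finset ℕ} (h : A.card = k) : Set.range (enum k A) = A := by
  rw [enum, dif_pos h]
  exact A.range_orderEmbOfFin h

theorem exists_perm_of_range_eq {ι α : Type*} {v w : ι → α} (hv : Function.Injective v)
    (hw : Function.Injective w) (h : Set.range v = Set.range w) : ∃ σ : Equiv.Perm ι, v = w ∘ σ := by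
  refine ⟨(Equiv.ofInjective v hv).trans ((Equiv.setCongr h).trans (Equiv.ofInjective w hw).symm), ?_⟩
  ext i
  simp [Equiv.apply_ofInjective_symm hw]

theorem abs_det_vandermonde_comp {k : ℕ} (v : Fin k → ℤ) (σ : Equiv.Perm (Fin k)) :
    |(Matrix.vandermonde (v ∘ σ)).det| = |(Matrix.vandermonde v).det| := by
  have : Matrix.vandermonde (v ∘ σ) = (Matrix.vandermonde v).submatrix σ (Equiv.refl _) := by
    ext i j
    simp [Matrix.vandermonde]
  rw [this, Matrix.abs_det_submatrix_equiv_equiv]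

theorem det_vandermonde_cons {k : ℕ} (x : ℤ) (v : Fin k → ℤ) :
    (Matrix.vandermonde (Fin.cons x v : Fin (k + 1) → ℤ)).det =
      (∏ i, (v i - x)) * (Matrix.vandermonde v).det := by
  rw [Matrix.det_vandermonde, Matrix.det_vandermonde, Fin.prod_univ_succ, Fin.prod_Ioi_zero]
  simp [Fin.prod_Ioi_succ]

theorem det_vandermonde_nonneg {k : ℕ} {v : Fin k → ℤ} (hv : StrictMono v) :
    0 ≤ (Matrix.vandermonde v).det := by
  rw [Matrix.det_vandermonde]
  refine Finset.prod_nonneg fun i _ => Finset.prod_nonneg fun j hj => ?_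
  exact sub_nonneg.2 (hv (Finset.mem_Ioi.1 hj)).le

/-- `j! * x.choose j` is the falling factorial, a monic polynomial in `x` of degree `j`. -/
theorem prod_factorial_mul_det_choose {k : ℕ} (v : Fin k → ℕ) :
    (∏ i : Fin k, (Nat.factorial i : ℤ)) * (Matrix.of fun i j : Fin k => ((v i).choose j : ℤ)).det =
      (Matrix.vandermonde fun i => (v i : ℤ)).det := by
  rw [Matrix.det_eval_matrixOfPolynomials_eq_det_vandermonde _ (fun i => descPochhammer ℤ i)
    (fun i => descPochhammer_natDegree ℤ i) (fun i => monic_descPochhammer ℤ i),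
    ← Matrix.det_mul_row]
  congr 1
  ext i j
  rw [Matrix.of_apply, Matrix.of_apply, Matrix.of_apply, descPochhammer_eval_eq_descFactorial,
    Nat.descFactorial_eq_factorial_mul_choose]
  push_cast
  rfl

theorem prod_factorial_mul_dentDet {k : ℕ} {A : Finset ℕ} (h : A.card = k) :
    (∏ i : Fin k, (Nat.factorial i : ℤ)) * dentDet A =
      (Matrix.vandermonde fun i => (enum k A i : ℤ)).det := by
  subst h
  rw [← prod_factorial_mul_det_choose, dentDet, enum, dif_pos rfl]

/-- Placing `n` in front instead of in its sorted position changes the Vandermonde determinant only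
by a sign. Both sorted determinants are nonnegative, so taking absolute values leaves the factors
`|x - n|`. -/
theorem prod_factorial_mul_dentDet_insert {k n : ℕ} {A : Finset ℕ} (h : A.card = k) (hn : n ∉ A) :
    (∏ i : Fin (k + 1), (Nat.factorial i : ℤ)) * dentDet (insert n A) =
      (∏ i, |(enum k A i : ℤ) - n|) * (Matrix.vandermonde fun i => (enum k A i : ℤ)).det := by
  have hcard : (insert n A).card = k + 1 := by rw [Finset.card_insert_of_notMem hn, h]
  have hcons : Function.Injective (Fin.cons n (enum k A) : Fin (k + 1) → ℕ) := by
    rw [Fin.cons_injective_iff, range_enum h]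
    exact ⟨by simpa using hn, enum_injective h⟩
  obtain ⟨σ, hσ⟩ := exists_perm_of_range_eq (enum_injective hcard) hcons (by
    rw [range_enum hcard, Fin.range_cons, range_enum h, Finset.coe_insert])
  have h1 : (fun i => (enum (k + 1) (insert n A) i : ℤ)) =
      (Fin.cons (n : ℤ) (fun i => (enum k A i : ℤ)) : Fin (k + 1) → ℤ) ∘ σ := by
    rw [hσ]
    ext i
    simp only [Function.comp_apply]
    refine Fin.cases ?_ (fun j => ?_) (σ i) <;> simp
  have hmono : StrictMono fun i => (enum (k + 1) (insert n A) i : ℤ) :=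
    Nat.strictMono_cast.comp (strictMono_enum hcard)
  have hmono' : StrictMono fun i => (enum k A i : ℤ) :=
    Nat.strictMono_cast.comp (strictMono_enum h)
  rw [prod_factorial_mul_dentDet hcard, ← abs_of_nonneg (det_vandermonde_nonneg hmono), h1,
    abs_det_vandermonde_comp, det_vandermonde_cons, abs_mul, Finset.abs_prod,
    abs_of_nonneg (det_vandermonde_nonneg hmono')]

/-- The Cauchy–Binet formula. -/
theorem det_sum_mul_eq {R : Type*} [CommRing R] {k : ℕ} (X : Finset ℕ) (f g : ℕ → Fin k → R) :
    (Matrix.of fun i j => ∑ x ∈ X, f x i * g x j).det =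
      ∑ A ∈ Finset.powersetCard k X, (Matrix.of fun i j => f (enum k A i) j).det *
        (Matrix.of fun i j => g (enum k A i) j).det := by
  classical
  have h1 : (Matrix.of fun i j => ∑ x ∈ X, f x i * g x j).det =
      ∑ φ ∈ Fintype.piFinset fun _ : Fin k => X,
        (∏ i, f (φ i) i) * (Matrix.of fun i j => g (φ i) j).det := by
    have := (Matrix.detRowAlternating (n := Fin k) (R := R)).toMultilinearMap.map_sum_finset
      (fun i x => f x i • g x) (fun _ => X)
    simp only [AlternatingMap.coe_multilinearMap] at this
    have h2 : (Matrix.of fun i j => ∑ x ∈ X, f x i * g x j) =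
        fun i => ∑ x ∈ X, f x i • g x := by
      ext i j
      simp [Finset.sum_apply]
    rw [h2]
    refine this.trans (Finset.sum_congr rfl fun φ _ => ?_)
    exact (Matrix.detRowAlternating (n := Fin k) (R := R)).map_smul_univ _ _
  -- A choice of rows with a repetition contributes nothing; the injective choices are then grouped
  -- by their image, each group being an orbit of permutations.
  have h2 : ∑ φ ∈ Fintype.piFinset fun _ : Fin k => X,
        (∏ i, f (φ i) i) * (Matrix.of fun i j => g (φ i) j).det =
      ∑ φ ∈ (Fintype.piFinset fun _ : Fin k => X).filter Function.Injective,
        (∏ i, f (φ i) i) * (Matrix.of fun i j => g (φ i) j).det := by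
    rw [Finset.sum_filter_of_ne]
    intro φ _ hφ i j hij
    by_contra hne
    exact hφ (by rw [Matrix.det_zero_of_row_eq hne (by ext; simp [hij]), mul_zero])
  rw [h1, h2, ← Finset.sum_fiberwise_of_maps_to (t := Finset.powersetCard k X)
    (g := fun φ => Finset.univ.image φ)]
  · refine Finset.sum_congr rfl fun A hA => ?_
    obtain ⟨hAX, hAk⟩ := Finset.mem_powersetCard.1 hA
    have h3 : ∑ σ : Equiv.Perm (Fin k), (∏ i, f (enum k A (σ i)) i) *
        (Matrix.of fun i j => g (enum k A (σ i)) j).det =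
        (Matrix.of fun i j => f (enum k A i) j).det *
        (Matrix.of fun i j => g (enum k A i) j).det := by
      rw [Matrix.det_apply (Matrix.of fun i j => f (enum k A i) j), Finset.sum_mul]
      refine Finset.sum_congr rfl fun σ _ => ?_
      have := Matrix.det_permute σ (Matrix.of fun i j => g (enum k A i) j)
      rw [show (Matrix.of fun i j => g (enum k A (σ i)) j) =
        (Matrix.of fun i j => g (enum k A i) j).submatrix σ id from rfl, this]
      simp only [Matrix.of_apply, Units.smul_def, zsmul_eq_mul]
      ring
    rw [← h3]
    symm
    refine Finset.sum_bij (fun σ _ => enum k A ∘ σ) ?_ ?_ ?_ ?_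
    · intro σ _
      rw [Finset.mem_filter, Finset.mem_filter, Fintype.mem_piFinset]
      refine ⟨⟨fun i => hAX ?_, (enum_injective hAk).comp σ.injective⟩, ?_⟩
      · have := Finset.mem_image_of_mem (enum k A) (Finset.mem_univ (σ i))
        rwa [image_enum hAk] at this
      · rw [← Finset.image_image, Finset.image_univ_equiv σ, image_enum hAk]
    · intro σ _ τ _ h
      ext i
      exact congrArg _ (enum_injective hAk (congrFun h i))
    · intro φ hφ
      rw [Finset.mem_filter, Finset.mem_filter] at hφ
      obtain ⟨σ, hσ⟩ := exists_perm_of_range_eq hφ.1.2 (enum_injective hAk) (by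
        rw [range_enum hAk, ← hφ.2]; simp)
      exact ⟨σ, Finset.mem_univ _, hσ.symm⟩
    · intro σ _
      rfl
  · intro φ hφ
    rw [Finset.mem_filter, Fintype.mem_piFinset] at hφ
    rw [Finset.mem_powersetCard]
    refine ⟨?_, ?_⟩
    · intro x hx
      obtain ⟨i, -, rfl⟩ := Finset.mem_image.1 hx
      exact hφ.1 i
    · rw [Finset.card_image_of_injective _ hφ.2, Finset.card_univ, Fintype.card_fin]

-- One Vandermonde factor is written with the `p i` and carries the weight; the other is written
-- with the `r j`. Translating all nodes by `n` does not change a Vandermonde determinant.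
open Polynomial in
theorem numTilingsNoCenter_mul_prod_factorial {n k : ℕ} (hk : k ≤ 2 * n) (p r : ℕ → ℚ[X])
    (hp : ∀ i, (p i).Monic) (hp' : ∀ i, (p i).natDegree = i)
    (hr : ∀ i, (r i).Monic) (hr' : ∀ i, (r i).natDegree = i) :
    (numTilingsNoCenter n k : ℚ) * ((∏ i ∈ Finset.range k, (Nat.factorial i : ℚ)) *
      ∏ i ∈ Finset.range (k + 1), (Nat.factorial i : ℚ)) =
    (Matrix.of fun i j : Fin k => ∑ x ∈ Finset.range (2 * n + 1),
      |(x : ℚ) - n| * (p i).eval ((x : ℚ) - n) * (r j).eval ((x : ℚ) - n)).det := by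
  have h1 : (Matrix.of fun i j : Fin k => ∑ x ∈ Finset.range (2 * n + 1),
      |(x : ℚ) - n| * (p i).eval ((x : ℚ) - n) * (r j).eval ((x : ℚ) - n)) =
      Matrix.of fun i j : Fin k => ∑ x ∈ (Finset.range (2 * n + 1)).erase n,
      |(x : ℚ) - n| * (p i).eval ((x : ℚ) - n) * (r j).eval ((x : ℚ) - n) := by
    ext i j
    -- The excluded position `n` may be put back because its weight is `0`.
    rw [Matrix.of_apply, Matrix.of_apply, Finset.sum_erase]
    simp
  rw [h1, det_sum_mul_eq _ (fun x i => |(x : ℚ) - n| * (p i).eval ((x : ℚ) - n))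
    (fun x j => (r j).eval ((x : ℚ) - n))]
  have hN : (numTilingsNoCenter n k : ℚ) = ((numTilingsNoCenter n k : ℤ) : ℚ) := by simp
  rw [hN, numTilingsNoCenter_eq_sum hk, Int.cast_sum, Finset.sum_mul]
  refine Finset.sum_congr rfl fun A hA => ?_
  obtain ⟨hAX, hAk⟩ := Finset.mem_powersetCard.1 hA
  have hnA : n ∉ A := fun h => by simpa using hAX h
  have e1 := congrArg (Int.cast : ℤ → ℚ) (prod_factorial_mul_dentDet hAk)
  have e2 := congrArg (Int.cast : ℤ → ℚ) (prod_factorial_mul_dentDet_insert hAk hnA)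
  have hV : (((Matrix.vandermonde fun i => (enum k A i : ℤ)).det : ℤ) : ℚ) =
      (Matrix.vandermonde fun i => (enum k A i : ℚ) - n).det := by
    rw [Matrix.det_vandermonde_sub, Matrix.det_vandermonde, Matrix.det_vandermonde]
    push_cast
    rfl
  rw [Int.cast_mul, hV] at e1
  rw [Int.cast_mul, Int.cast_mul, hV] at e2
  push_cast at e1 e2
  have e3 : (Matrix.of fun i j : Fin k => (r j).eval ((enum k A i : ℚ) - n)).det =
      (Matrix.vandermonde fun i => (enum k A i : ℚ) - n).det :=
    (Matrix.det_eval_matrixOfPolynomials_eq_det_vandermonde _ (fun j : Fin k => r j)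
      (fun i => hr' i) (fun i => hr i)).symm
  have e4 : (Matrix.of fun i j : Fin k => |(enum k A i : ℚ) - n| *
      (p j).eval ((enum k A i : ℚ) - n)).det =
      (∏ i, |(enum k A i : ℚ) - n|) * (Matrix.vandermonde fun i => (enum k A i : ℚ) - n).det := by
    rw [Matrix.det_eval_matrixOfPolynomials_eq_det_vandermonde _ (fun j : Fin k => p j)
      (fun i => hp' i) (fun i => hp i), ← Matrix.det_mul_column]
    rfl
  rw [e3, e4, ← e2, Fin.prod_univ_eq_prod_range (fun i => (Nat.factorial i : ℚ)) (k + 1), ← e1,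
    Fin.prod_univ_eq_prod_range (fun i => (Nat.factorial i : ℚ)) k]
  push_cast
  ring

/-! ### Parity splitting and closed forms of the pairings -/

open Polynomial

/-- The polynomial `x ^ (i % 2) * ∏ (x ^ 2 - a l)` of degree `i`, which is even or odd like `i`. -/
noncomputable def parityPoly (a : ℕ → ℚ) (i : ℕ) : ℚ[X] :=
  X ^ (i % 2) * ∏ l ∈ Finset.range (i / 2), (X ^ 2 - C (a l))

theorem monic_parityPoly (a : ℕ → ℚ) (i : ℕ) : (parityPoly a i).Monic :=
  (monic_X_pow _).mul (monic_prod_of_monic _ _ fun _ _ => monic_X_pow_sub_C _ two_ne_zero)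

theorem natDegree_parityPoly (a : ℕ → ℚ) (i : ℕ) : (parityPoly a i).natDegree = i := by
  rw [parityPoly, (monic_X_pow _).natDegree_mul
    (monic_prod_of_monic _ _ fun _ _ => monic_X_pow_sub_C _ two_ne_zero),
    natDegree_prod_of_monic _ _ fun _ _ => monic_X_pow_sub_C _ two_ne_zero]
  simp only [natDegree_X_pow, natDegree_X_pow_sub_C, Finset.sum_const, Finset.card_range, smul_eq_mul]
  omega

theorem eval_parityPoly (a : ℕ → ℚ) (i : ℕ) (y : ℚ) :
    (parityPoly a i).eval y = y ^ (i % 2) * ∏ l ∈ Finset.range (i / 2), (y ^ 2 - a l) := by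
  simp [parityPoly, eval_prod]

theorem sum_range_two_mul_add_one (g : ℚ → ℚ) (n : ℕ) :
    ∑ x ∈ Finset.range (2 * n + 1), g ((x : ℚ) - n) =
      g 0 + ∑ y ∈ Finset.range n, (g (y + 1) + g (-(y + 1))) := by
  induction n with
  | zero => simp
  | succ n ih =>
    rw [show 2 * (n + 1) + 1 = 2 * n + 1 + 1 + 1 by ring, Finset.sum_range_succ,
      Finset.sum_range_succ', Finset.sum_range_succ _ n, ← add_assoc, ← ih]
    have h : ∀ x : ℕ, ((x + 1 : ℕ) : ℚ) - (n + 1 : ℕ) = x - n := fun x => by push_cast; ring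
    simp only [h]
    push_cast
    rw [show (2 * (n : ℚ) + 1 - n) = n + 1 by ring, show (0 : ℚ) - (n + 1) = -(n + 1) by ring]
    ring

/-- The bilinear pairing of `∏ (y ^ 2 - (l + 1) ^ 2)` and `∏ (y ^ 2 - (n + l + 1) ^ 2)` with respect
to the weight `y ^ e` on `{1, …, n}`. -/
def pairing (e n i j : ℕ) : ℚ :=
  ∑ y ∈ Finset.range n, ((y : ℚ) + 1) ^ e *
    (∏ l ∈ Finset.range i, (((y : ℚ) + 1) ^ 2 - ((l : ℚ) + 1) ^ 2)) *
    ∏ l ∈ Finset.range j, (((y : ℚ) + 1) ^ 2 - ((n : ℚ) + l + 1) ^ 2)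

/-- The terms at `y` and `-y` cancel for opposite parities and double for equal ones, where the odd
case contributes an extra `y ^ 2` to the weight. The row roots `1, 2, ...` and column roots `n + 1,
n + 2, ...` are chosen so that the pairings have product form. -/
theorem sum_abs_mul_parityPoly (n i j : ℕ) :
    ∑ x ∈ Finset.range (2 * n + 1), |(x : ℚ) - n| *
      (parityPoly (fun l => ((l : ℚ) + 1) ^ 2) i).eval ((x : ℚ) - n) *
      (parityPoly (fun l => ((n : ℚ) + l + 1) ^ 2) j).eval ((x : ℚ) - n) =
    if i % 2 = j % 2 then 2 * pairing (2 * (i % 2) + 1) n (i / 2) (j / 2) else 0 := by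
  rw [sum_range_two_mul_add_one (fun y => |y| *
      (parityPoly (fun l => ((l : ℚ) + 1) ^ 2) i).eval y *
      (parityPoly (fun l => ((n : ℚ) + l + 1) ^ 2) j).eval y)]
  simp only [eval_parityPoly, abs_zero, zero_mul, zero_add, abs_neg, neg_sq]
  have habs : ∀ y : ℕ, |(y : ℚ) + 1| = y + 1 := fun y => abs_of_nonneg (by positivity)
  simp only [habs]
  split_ifs with h
  · rw [pairing, Finset.mul_sum]
    refine Finset.sum_congr rfl fun y _ => ?_
    rw [← h]
    rcases Nat.mod_two_eq_zero_or_one i with h' | h' <;> rw [h'] <;> ring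
  · refine Finset.sum_eq_zero fun y _ => ?_
    rcases Nat.mod_two_eq_zero_or_one i with h' | h' <;>
      rcases Nat.mod_two_eq_zero_or_one j with h'' | h'' <;>
      first
      | exact absurd (h'.trans h''.symm) h
      | (rw [h', h'']; ring)

theorem cast_descFactorial_succ (n k : ℕ) :
    (n.descFactorial (k + 1) : ℚ) = ((n : ℚ) - k) * n.descFactorial k := by
  rcases le_or_gt k n with h | h
  · rw [Nat.descFactorial_succ, Nat.cast_mul, Nat.cast_sub h]
  · rw [Nat.descFactorial_of_lt h, Nat.descFactorial_of_lt (h.trans (Nat.lt_succ_self k))]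
    simp

theorem cast_factorial_succ (n : ℕ) : ((n + 1).factorial : ℚ) = ((n : ℚ) + 1) * n.factorial := by
  rw [Nat.factorial_succ]; push_cast; ring

theorem cast_factorial_ne_zero (n : ℕ) : (n.factorial : ℚ) ≠ 0 :=
  Nat.cast_ne_zero.2 n.factorial_ne_zero

theorem mul_prod_sq_sub_sq (n i : ℕ) :
    ((n : ℚ) + 1) * ∏ l ∈ Finset.range i, (((n : ℚ) + 1) ^ 2 - ((l : ℚ) + 1) ^ 2) =
      n.descFactorial i * (n + i + 1).factorial / n.factorial := by
  have := cast_factorial_ne_zero n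
  induction i with
  | zero =>
    rw [add_zero, cast_factorial_succ]
    simp
    field_simp
  | succ i ih =>
    rw [Finset.prod_range_succ, ← mul_assoc, ih, cast_descFactorial_succ,
      show n + (i + 1) + 1 = n + i + 1 + 1 by ring, cast_factorial_succ (n + i + 1)]
    push_cast
    field_simp
    ring

/-- With no column factor, the summand is a ratio of factorials by `mul_prod_sq_sub_sq`, and its sum
over `y` telescopes. -/
theorem pairing_one_zero (n i : ℕ) :
    pairing 1 n i 0 =
      n.descFactorial (i + 1) * (n + i + 1).factorial / (2 * (i + 1) * n.factorial) := by
  simp only [pairing, pow_one, Finset.range_zero, Finset.prod_empty, mul_one]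
  induction n with
  | zero => simp
  | succ n ih =>
    have := cast_factorial_ne_zero n
    have hi : (i : ℚ) + 1 ≠ 0 := by positivity
    have hn : (n : ℚ) + 1 ≠ 0 := by positivity
    rw [Finset.sum_range_succ, ih, mul_prod_sq_sub_sq, Nat.succ_descFactorial_succ,
      show n + 1 + i + 1 = n + i + 1 + 1 by ring, cast_factorial_succ (n + i + 1),
      cast_factorial_succ n, cast_descFactorial_succ]
    push_cast
    field_simp
    ring

theorem pairing_succ_left (e n i j : ℕ) :
    pairing (e + 2) n i j = pairing e n (i + 1) j + ((i : ℚ) + 1) ^ 2 * pairing e n i j := by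
  simp only [pairing]
  rw [Finset.mul_sum, ← Finset.sum_add_distrib]
  refine Finset.sum_congr rfl fun y _ => ?_
  rw [Finset.prod_range_succ]
  ring

/-- The new column factor `y ^ 2 - (n + j + 1) ^ 2` is the next row factor `y ^ 2 - (i + 1) ^ 2`
plus a constant. This gives an induction on `j` in which `i` varies. -/
theorem pairing_succ_right (e n i j : ℕ) :
    pairing e n i (j + 1) = pairing e n (i + 1) j +
      (((i : ℚ) + 1) ^ 2 - ((n : ℚ) + j + 1) ^ 2) * pairing e n i j := by
  simp only [pairing]
  rw [Finset.mul_sum, ← Finset.sum_add_distrib]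
  refine Finset.sum_congr rfl fun y _ => ?_
  rw [Finset.prod_range_succ, Finset.prod_range_succ]
  ring

theorem pairing_one (n i j : ℕ) :
    pairing 1 n i j = (-1) ^ j * (i.factorial * j.factorial * (n + j).factorial *
      (n + i + j + 1).factorial * n.descFactorial (i + 1) /
        (2 * n.factorial ^ 2 * (i + j + 1).factorial)) := by
  induction j generalizing i with
  | zero =>
    have := cast_factorial_ne_zero n
    have := cast_factorial_ne_zero i
    have hi : (i : ℚ) + 1 ≠ 0 := by positivity
    rw [pairing_one_zero]
    simp only [add_zero, cast_factorial_succ i, Nat.factorial_zero, pow_zero]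
    push_cast
    field_simp
  | succ j ih =>
    have := cast_factorial_ne_zero n
    have := cast_factorial_ne_zero (i + j + 1)
    have hi : (i : ℚ) + j + 1 + 1 ≠ 0 := by positivity
    rw [pairing_succ_right, ih, ih, show n + (i + 1) + j + 1 = n + i + j + 1 + 1 by ring,
      show n + i + (j + 1) + 1 = n + i + j + 1 + 1 by ring,
      show i + 1 + j + 1 = i + j + 1 + 1 by ring,
      show i + (j + 1) + 1 = i + j + 1 + 1 by ring, ← add_assoc n j 1,
      cast_factorial_succ (n + i + j + 1), cast_factorial_succ (i + j + 1), cast_factorial_succ i,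
      cast_factorial_succ j, cast_factorial_succ (n + j), cast_descFactorial_succ n (i + 1)]
    push_cast
    field_simp
    ring

theorem pairing_three (n i j : ℕ) :
    pairing 3 n i j = (-1) ^ j * ((i + 1).factorial * j.factorial * (n + j + 1).factorial *
      (n + i + j + 1).factorial * n * n.descFactorial (i + 1) /
        (2 * n.factorial ^ 2 * (i + j + 2).factorial)) := by
  have := cast_factorial_ne_zero n
  have := cast_factorial_ne_zero (i + j + 1)
  have hi : (i : ℚ) + j + 1 + 1 ≠ 0 := by positivity
  rw [pairing_succ_left 1, pairing_one, pairing_one,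
    show n + (i + 1) + j + 1 = n + i + j + 1 + 1 by ring,
    show i + 1 + j + 1 = i + j + 1 + 1 by ring, show i + j + 2 = i + j + 1 + 1 by ring,
    cast_factorial_succ (n + i + j + 1), cast_factorial_succ (i + j + 1), cast_factorial_succ i,
    cast_factorial_succ (n + j), cast_descFactorial_succ n (i + 1)]
  push_cast
  field_simp
  ring

/-- Listing the even indices before the odd ones, for rows and columns alike, makes the matrix block
diagonal. -/
theorem det_checkerboard {R : Type*} [CommRing R] (k : ℕ) (M : ℕ → ℕ → R)
    (hM : ∀ i j, i % 2 ≠ j % 2 → M i j = 0) :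
    (Matrix.of fun i j : Fin k => M i j).det =
      (Matrix.of fun i j : Fin ((k + 1) / 2) => M (2 * i) (2 * j)).det *
        (Matrix.of fun i j : Fin (k / 2) => M (2 * i + 1) (2 * j + 1)).det := by
  let f : Fin ((k + 1) / 2) ⊕ Fin (k / 2) → Fin k :=
    Sum.elim (fun i => ⟨2 * i, by omega⟩) (fun i => ⟨2 * i + 1, by omega⟩)
  have hf : Function.Bijective f := by
    constructor
    · rintro (a | a) (b | b) h <;> simp [f, Fin.ext_iff] at h ⊢ <;> omega
    · intro x
      by_cases hx : (x : ℕ) % 2 = 0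
      · exact ⟨Sum.inl ⟨x / 2, by omega⟩, by simp [f, Fin.ext_iff]; omega⟩
      · exact ⟨Sum.inr ⟨x / 2, by omega⟩, by simp [f, Fin.ext_iff]; omega⟩
  rw [← Matrix.det_submatrix_equiv_self (Equiv.ofBijective f hf), ← Matrix.det_fromBlocks_zero₂₁ _ 0]
  congr 1
  ext (i | i) (j | j)
  · simp [f]
  · simp only [f, Matrix.submatrix_apply, Equiv.ofBijective_apply, Sum.elim_inl, Sum.elim_inr,
      Matrix.of_apply, Matrix.fromBlocks_apply₁₂, Matrix.zero_apply]
    exact hM _ _ (by omega)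
  · simp only [f, Matrix.submatrix_apply, Equiv.ofBijective_apply, Sum.elim_inl, Sum.elim_inr,
      Matrix.of_apply, Matrix.fromBlocks_apply₂₁, Matrix.zero_apply]
    exact hM _ _ (by omega)
  · simp [f]

theorem numTilingsNoCenter_mul_eq_abs_det_mul {n k : ℕ} (hk : k ≤ 2 * n) :
    (numTilingsNoCenter n k : ℚ) * ((∏ i ∈ Finset.range k, (Nat.factorial i : ℚ)) *
      ∏ i ∈ Finset.range (k + 1), (Nat.factorial i : ℚ)) =
    |(Matrix.of fun i j : Fin ((k + 1) / 2) => 2 * pairing 1 n i j).det| *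
      |(Matrix.of fun i j : Fin (k / 2) => 2 * pairing 3 n i j).det| := by
  rw [← abs_mul, ← abs_of_nonneg (show (0 : ℚ) ≤ (numTilingsNoCenter n k : ℚ) *
    ((∏ i ∈ Finset.range k, (Nat.factorial i : ℚ)) *
      ∏ i ∈ Finset.range (k + 1), (Nat.factorial i : ℚ)) by positivity),
    numTilingsNoCenter_mul_prod_factorial hk (parityPoly fun l => ((l : ℚ) + 1) ^ 2)
      (parityPoly fun l => ((n : ℚ) + l + 1) ^ 2) (monic_parityPoly _) (natDegree_parityPoly _)
      (monic_parityPoly _) (natDegree_parityPoly _)]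
  simp only [sum_abs_mul_parityPoly]
  rw [det_checkerboard k (fun i j => if i % 2 = j % 2 then
    2 * pairing (2 * (i % 2) + 1) n (i / 2) (j / 2) else 0) fun i j h => if_neg h]
  congr 3
  · ext i j
    simp
  · ext i j
    simp [Nat.add_mod, Nat.mul_add_div]

/-! ### Evaluation of the two determinants -/

theorem sum_choose_mul_choose (N c : ℕ) {i m : ℕ} (hi : i < m) :
    ∑ l ∈ Finset.range m, i.choose l * N.choose (c + l) = (N + i).choose (c + i) := by
  induction i generalizing c m with
  | zero =>
    obtain ⟨m, rfl⟩ := Nat.exists_eq_succ_of_ne_zero hi.ne'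
    rw [Finset.sum_range_succ']
    simp
  | succ i ih =>
    obtain ⟨m, rfl⟩ := Nat.exists_eq_succ_of_ne_zero (Nat.ne_of_gt (Nat.zero_lt_of_lt hi))
    have h1 := ih c (m := m + 1) (by omega)
    have h2 := ih (c + 1) (m := m) (by omega)
    rw [Finset.sum_range_succ'] at h1 ⊢
    simp only [Nat.choose_succ_succ i, add_mul, Finset.sum_add_distrib]
    rw [show N + (i + 1) = N + i + 1 by ring, show c + (i + 1) = c + i + 1 by ring,
      Nat.choose_succ_succ, ← h1, show (c + i).succ = c + 1 + i by omega, ← h2]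
    have h3 : ∀ l, N.choose (c + (l + 1)) = N.choose (c + 1 + l) := fun l => by
      rw [show c + (l + 1) = c + 1 + l by ring]
    simp only [Nat.choose_zero_right, h3]
    ring

/-- Chu–Vandermonde, read as a matrix factorization: the left factor is the Pascal matrix `i.choose
l`, which has determinant `1`, and the right factor is `1 / (l + j + b)!` up to row and column
factors. -/
theorem factorial_div_factorial_eq_sum (N b j : ℕ) {i m : ℕ} (hi : i < m) :
    ((N + b + i + j).factorial : ℚ) / (i + j + b).factorial =
      ∑ l ∈ Finset.range m, (i.choose l : ℚ) *
        ((N + b + j).factorial * N.descFactorial l * (1 / (l + j + b).factorial)) := by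
  have h0 := cast_factorial_ne_zero N
  have h1 : ∀ l, ((N + b + j).factorial * N.descFactorial l * (1 / (l + j + b).factorial) : ℚ) =
      N.factorial * (N + b + j).choose (b + j + l) := by
    intro l
    have h2 := cast_factorial_ne_zero (l + j + b)
    rcases le_or_gt l N with hl | hl
    · have h3 := cast_factorial_ne_zero (N - l)
      have h4 := Nat.choose_mul_factorial_mul_factorial (n := N + b + j) (k := b + j + l) (by omega)
      rw [show N + b + j - (b + j + l) = N - l by omega, show b + j + l = l + j + b by ring] at h4
      have h5 := Nat.factorial_mul_descFactorial hl
      rw [← h4, ← h5, show b + j + l = l + j + b by ring]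
      push_cast
      field_simp
    · rw [Nat.descFactorial_of_lt hl, Nat.choose_eq_zero_of_lt (by omega)]
      simp
  simp only [h1]
  have h6 := sum_choose_mul_choose (N + b + j) (b + j) hi
  have h7 : ∑ l ∈ Finset.range m, (i.choose l : ℚ) *
      (N.factorial * (N + b + j).choose (b + j + l)) =
      N.factorial * ((N + b + j + i).choose (b + j + i) : ℕ) := by
    rw [← h6]
    push_cast
    rw [Finset.mul_sum]
    exact Finset.sum_congr rfl fun l _ => by ring
  rw [h7, div_eq_iff (cast_factorial_ne_zero _)]
  have h8 := Nat.choose_mul_factorial_mul_factorial (n := N + b + j + i) (k := b + j + i) (by omega)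
  rw [show N + b + j + i - (b + j + i) = N by omega] at h8
  rw [show N + b + i + j = N + b + j + i by ring, ← h8, show i + j + b = b + j + i by ring]
  push_cast
  ring

theorem det_choose_eq_one (m : ℕ) :
    (Matrix.of fun i l : Fin m => ((i : ℕ).choose l : ℚ)).det = 1 := by
  rw [Matrix.det_of_isLowerTriangular]
  · simp
  · intro i j hij
    have : (i : ℕ) < j := hij
    simp [Nat.choose_eq_zero_of_lt this]

/-- Taking `1 / (l + m + b)!` out of row `l` leaves the falling factorial of `l + m + b` of degree
`m - 1 - j`. With the columns reversed this is a Vandermonde determinant at consecutive integers. -/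
theorem abs_det_inv_factorial (m b : ℕ) :
    |(Matrix.of fun l j : Fin m => 1 / ((l + j + (b + 1) : ℕ).factorial : ℚ)).det| =
      ∏ i ∈ Finset.range m, (i.factorial : ℚ) / (i + m + b).factorial := by
  have h1 : (Matrix.of fun l j : Fin m => 1 / ((l + j + (b + 1) : ℕ).factorial : ℚ)) =
      Matrix.of fun l j : Fin m => (1 / ((l + m + b : ℕ).factorial : ℚ)) *
        (Matrix.of fun l j : Fin m =>
          (descPochhammer ℚ j).eval ((l : ℚ) + (m + b))).submatrix (Equiv.refl _) Fin.revPerm l j := by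
    ext l j
    have hj := j.2
    simp only [Matrix.of_apply, Matrix.submatrix_apply, Equiv.refl_apply, Fin.revPerm_apply]
    rw [show (l : ℚ) + (m + b) = ((l + m + b : ℕ) : ℚ) by push_cast; ring,
      descPochhammer_eval_eq_descFactorial]
    have h2 := Nat.factorial_mul_descFactorial (n := l + m + b) (k := Fin.rev j)
      (by rw [Fin.val_rev]; omega)
    rw [show (l : ℕ) + m + b - Fin.rev j = l + j + (b + 1) by rw [Fin.val_rev]; omega] at h2
    rw [← h2]
    have := cast_factorial_ne_zero (l + j + (b + 1))
    have h3 : ((l + m + b : ℕ).descFactorial (Fin.rev j) : ℚ) ≠ 0 := by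
      rw [Nat.cast_ne_zero, Ne, Nat.descFactorial_eq_zero_iff_lt, Fin.val_rev]
      omega
    push_cast
    field_simp
  rw [h1, Matrix.det_mul_column, abs_mul, Matrix.abs_det_submatrix_equiv_equiv,
    ← Matrix.det_eval_matrixOfPolynomials_eq_det_vandermonde _ (fun i : Fin m => descPochhammer ℚ i)
    (fun i => descPochhammer_natDegree ℚ i) (fun i => monic_descPochhammer ℚ i),
    Matrix.det_vandermonde_add]
  have h4 : (Matrix.vandermonde fun l : Fin m => (l : ℚ)).det =
      ∏ i ∈ Finset.range m, (i.factorial : ℚ) := by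
    cases m with
    | zero => simp
    | succ m =>
      rw [Matrix.det_vandermonde_id_eq_superFactorial, ← Nat.prod_range_succ_factorial]
      push_cast
      rfl
  rw [h4, Fin.prod_univ_eq_prod_range (fun l => 1 / ((l + m + b : ℕ).factorial : ℚ)) m,
    abs_of_nonneg (Finset.prod_nonneg fun _ _ => by positivity),
    abs_of_nonneg (Finset.prod_nonneg fun _ _ => by positivity), ← Finset.prod_mul_distrib]
  exact Finset.prod_congr rfl fun i _ => by ring

theorem abs_det_factorial_div_factorial (m N b : ℕ) :
    |(Matrix.of fun i j : Fin m =>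
      ((N + (b + 1) + i + j).factorial : ℚ) / (i + j + (b + 1) : ℕ).factorial).det| =
      ∏ i ∈ Finset.range m, ((N + (b + 1) + i).factorial * N.descFactorial i *
        (i.factorial / (i + m + b).factorial) : ℚ) := by
  have h1 : (Matrix.of fun i j : Fin m =>
      ((N + (b + 1) + i + j).factorial : ℚ) / (i + j + (b + 1) : ℕ).factorial) =
      (Matrix.of fun i l : Fin m => ((i : ℕ).choose l : ℚ)) *
        Matrix.of fun l j : Fin m => ((N + (b + 1) + j).factorial : ℚ) *
          (Matrix.of fun l j : Fin m => (N.descFactorial l : ℚ) *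
            (Matrix.of fun l j : Fin m => 1 / ((l + j + (b + 1) : ℕ).factorial : ℚ)) l j) l j := by
    ext i j
    rw [Matrix.of_apply, factorial_div_factorial_eq_sum N (b + 1) j i.2, Matrix.mul_apply,
      ← Fin.sum_univ_eq_sum_range (fun l => ((i : ℕ).choose l : ℚ) *
        ((N + (b + 1) + j).factorial * N.descFactorial l * (1 / (l + j + (b + 1)).factorial))) m]
    refine Finset.sum_congr rfl fun l _ => ?_
    simp only [Matrix.of_apply]
    ring
  rw [h1, Matrix.det_mul, det_choose_eq_one, one_mul, Matrix.det_mul_row, Matrix.det_mul_column,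
    abs_mul, abs_mul, abs_det_inv_factorial,
    Fin.prod_univ_eq_prod_range (fun j => ((N + (b + 1) + j).factorial : ℚ)) m,
    Fin.prod_univ_eq_prod_range (fun j => (N.descFactorial j : ℚ)) m,
    abs_of_nonneg (Finset.prod_nonneg fun _ _ => by positivity),
    abs_of_nonneg (Finset.prod_nonneg fun _ _ => by positivity), ← Finset.prod_mul_distrib,
    ← Finset.prod_mul_distrib]
  exact Finset.prod_congr rfl fun i _ => by ring

/-- The product of the numbers `(n - l) * (n + l + 1)` for `l < m`. -/
def centralProd (n m : ℕ) : ℚ := ∏ l ∈ Finset.range m, (((n : ℚ) - l) * ((n : ℚ) + l + 1))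

theorem centralProd_succ (n m : ℕ) :
    centralProd n (m + 1) = centralProd n m * (((n : ℚ) - m) * ((n : ℚ) + m + 1)) :=
  Finset.prod_range_succ _ _

theorem descFactorial_mul_factorial (n m : ℕ) :
    (n.descFactorial m : ℚ) * (n + m).factorial = n.factorial * centralProd n m := by
  induction m with
  | zero => simp [centralProd]
  | succ m ih =>
    rw [cast_descFactorial_succ, ← add_assoc, cast_factorial_succ, centralProd_succ]
    push_cast
    linear_combination ((n : ℚ) - m) * ((n : ℚ) + m + 1) * ih

/-- In `pairing_one` only `(n + i + j + 1)! / (i + j + 1)!` couples the indices, so the factorial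
determinant applies with `N = n` and `b = 0`. -/
theorem abs_det_pairing_one (n m : ℕ) :
    |(Matrix.of fun i j : Fin m => 2 * pairing 1 n i j).det| =
      ∏ i ∈ Finset.range m, ((i.factorial : ℚ) ^ 3 * centralProd n i * centralProd n (i + 1) /
        (i + m).factorial) := by
  have h0 := cast_factorial_ne_zero n
  have h1 : (Matrix.of fun i j : Fin m => 2 * pairing 1 n i j) =
      Matrix.of fun i j : Fin m => ((i : ℕ).factorial * n.descFactorial (i + 1) / n.factorial : ℚ) *
        (Matrix.of fun i j : Fin m =>
          ((-1) ^ (j : ℕ) * ((j : ℕ).factorial * (n + j).factorial / n.factorial) : ℚ) *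
        (Matrix.of fun i j : Fin m =>
          ((n + (0 + 1) + i + j).factorial : ℚ) / (i + j + (0 + 1) : ℕ).factorial) i j) i j := by
    ext i j
    simp only [Matrix.of_apply]
    rw [pairing_one, show n + (0 + 1) + (i : ℕ) + j = n + i + j + 1 by ring]
    have := cast_factorial_ne_zero (i + j + 1)
    field_simp
  rw [h1, Matrix.det_mul_column, Matrix.det_mul_row, abs_mul, abs_mul,
    abs_det_factorial_div_factorial, Finset.abs_prod, Finset.abs_prod]
  simp only [abs_mul, abs_pow, abs_neg, abs_one, one_pow, one_mul, abs_div, Nat.abs_cast]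
  rw [Fin.prod_univ_eq_prod_range
      (fun i => ((i : ℕ).factorial * n.descFactorial (i + 1) / n.factorial : ℚ)) m,
    Fin.prod_univ_eq_prod_range
      (fun j => ((j : ℕ).factorial * (n + j).factorial / n.factorial : ℚ)) m,
    ← Finset.prod_mul_distrib, ← Finset.prod_mul_distrib]
  refine Finset.prod_congr rfl fun i _ => ?_
  have h2 := descFactorial_mul_factorial n i
  have h3 := descFactorial_mul_factorial n (i + 1)
  rw [← add_assoc] at h3
  have := cast_factorial_ne_zero (i + m)
  rw [show n + (0 + 1) + i = n + i + 1 by ring, add_zero]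
  field_simp
  linear_combination (n.descFactorial (i + 1) * (n + i + 1).factorial : ℚ) * h2 +
    n.factorial * centralProd n i * h3

/-- Here the coupling factor is `(n + i + j + 1)! / (i + j + 2)!`, whose arguments differ by `n -
1`: this is the factorial determinant with `N = n - 1` and `b = 1`, so `n = 0` is treated apart. -/
theorem abs_det_pairing_three {n m : ℕ} (hm : m ≤ n) :
    |(Matrix.of fun i j : Fin m => 2 * pairing 3 n i j).det| =
      ∏ i ∈ Finset.range m, (((i + 1).factorial : ℚ) * i.factorial ^ 2 * centralProd n (i + 1) ^ 2 /
        (i + m + 1).factorial) := by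
  rcases Nat.eq_zero_or_pos n with rfl | hn
  · obtain rfl : m = 0 := by omega
    simp
  obtain ⟨N, rfl⟩ : ∃ N, n = N + 1 := ⟨n - 1, by omega⟩
  set n := N + 1 with hnN
  have h0 := cast_factorial_ne_zero n
  have h1 : (Matrix.of fun i j : Fin m => 2 * pairing 3 n i j) =
      Matrix.of fun i j : Fin m =>
        (((i : ℕ) + 1).factorial * n.descFactorial (i + 1) / n.factorial : ℚ) *
        (Matrix.of fun i j : Fin m =>
          ((-1) ^ (j : ℕ) * ((j : ℕ).factorial * (n + j + 1).factorial * n / n.factorial) : ℚ) *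
        (Matrix.of fun i j : Fin m =>
          ((N + (1 + 1) + i + j).factorial : ℚ) / (i + j + (1 + 1) : ℕ).factorial) i j) i j := by
    ext i j
    simp only [Matrix.of_apply]
    rw [pairing_three, show N + (1 + 1) + (i : ℕ) + j = n + i + j + 1 by omega]
    have := cast_factorial_ne_zero (i + j + (1 + 1))
    have := cast_factorial_ne_zero (i + j + 2)
    field_simp
  rw [h1, Matrix.det_mul_column, Matrix.det_mul_row, abs_mul, abs_mul,
    abs_det_factorial_div_factorial, Finset.abs_prod, Finset.abs_prod]
  simp only [abs_mul, abs_pow, abs_neg, abs_one, one_pow, one_mul, abs_div, Nat.abs_cast]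
  rw [Fin.prod_univ_eq_prod_range
      (fun i => ((i + 1 : ℕ).factorial * n.descFactorial (i + 1) / n.factorial : ℚ)) m,
    Fin.prod_univ_eq_prod_range
      (fun j => ((j : ℕ).factorial * (n + j + 1).factorial * n / n.factorial : ℚ)) m,
    ← Finset.prod_mul_distrib, ← Finset.prod_mul_distrib]
  refine Finset.prod_congr rfl fun i _ => ?_
  have h3 := descFactorial_mul_factorial n (i + 1)
  have h4 : (n.descFactorial (i + 1) : ℚ) = n * N.descFactorial i := by
    rw [hnN, Nat.succ_descFactorial_succ]
    push_cast
    ring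
  rw [← add_assoc] at h3
  have := cast_factorial_ne_zero (i + m + 1)
  rw [show N + (1 + 1) + i = n + i + 1 by omega]
  field_simp
  rw [show (n.descFactorial (i + 1) : ℚ) * (n + i + 1).factorial ^ 2 * n * N.descFactorial i =
    ((n.descFactorial (i + 1) : ℚ) * (n + i + 1).factorial) ^ 2 by rw [h4]; ring, h3]
  ring

/-! ### Comparison with the stated products -/

theorem prod_range_odd (q : ℕ) :
    ((2 * q).factorial : ℚ) = 2 ^ q * q.factorial * ∏ j ∈ Finset.Ico 1 q, (2 * (j : ℚ) + 1) ∧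
    ((2 * q + 1).factorial : ℚ) = 2 ^ q * q.factorial * ∏ j ∈ Finset.Icc 1 q, (2 * (j : ℚ) + 1) := by
  induction q with
  | zero => simp
  | succ q ih =>
    obtain ⟨h1, h2⟩ := ih
    have h3 : ((2 * (q + 1)).factorial : ℚ) =
        2 ^ (q + 1) * (q + 1).factorial * ∏ j ∈ Finset.Icc 1 q, (2 * (j : ℚ) + 1) := by
      rw [show 2 * (q + 1) = 2 * q + 1 + 1 by ring, cast_factorial_succ, h2, cast_factorial_succ q]
      push_cast
      ring
    refine ⟨h3, ?_⟩
    rw [cast_factorial_succ, h3, Finset.prod_Icc_succ_top (by omega)]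
    push_cast
    ring

/-- The value of the right hand side of the formula for `k = 2 * q`. -/
def evenFormula (n q : ℕ) : ℚ :=
  (∏ i ∈ Finset.range q, (((n : ℚ) - i) * ((n : ℚ) + i + 1)) ^ (4 * (q - i) - 1)) /
    (2 ^ ((2 * q - 1) * (2 * q)) * ∏ j ∈ Finset.Ico 1 q, (2 * (j : ℚ) + 1) ^ (8 * (q - j) - 2))

/-- The value of the right hand side of the formula for `k = 2 * q + 1`. -/
def oddFormula (n q : ℕ) : ℚ :=
  (∏ i ∈ Finset.range (q + 1), (((n : ℚ) - i) * ((n : ℚ) + i + 1)) ^ (4 * (q - i) + 1)) /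
    (2 ^ ((2 * q) * (2 * q + 1)) * ∏ j ∈ Finset.Icc 1 q, (2 * (j : ℚ) + 1) ^ (8 * (q - j) + 2))

/-- The ratio of the formulas for `k = 2 * q + 1` and `k = 2 * q`. The odd numbers and powers of two
in the denominators are absorbed into `(2 * q)!` and `(2 * q + 1)!` by `prod_range_odd`. -/
theorem oddFormula_eq (n q : ℕ) :
    oddFormula n q * ((2 * q).factorial ^ 2 * (2 * q + 1).factorial ^ 2) =
      evenFormula n q * (q.factorial ^ 4 * centralProd n q * centralProd n (q + 1)) := by
  obtain ⟨h1, h2⟩ := prod_range_odd q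
  have hnum : ∏ i ∈ Finset.range (q + 1), (((n : ℚ) - i) * ((n : ℚ) + i + 1)) ^ (4 * (q - i) + 1) =
      (∏ i ∈ Finset.range q, (((n : ℚ) - i) * ((n : ℚ) + i + 1)) ^ (4 * (q - i) - 1)) *
        centralProd n q * centralProd n (q + 1) := by
    rw [Finset.prod_range_succ, centralProd_succ, ← mul_assoc, centralProd, ← Finset.prod_mul_distrib, ← Finset.prod_mul_distrib, Nat.sub_self, mul_zero,
      zero_add, pow_one]
    congr 1
    refine Finset.prod_congr rfl fun i hi => ?_
    rw [Finset.mem_range] at hi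
    rw [show 4 * (q - i) + 1 = 4 * (q - i) - 1 + 1 + 1 by omega, pow_succ, pow_succ]
  have hden : ∏ j ∈ Finset.Icc 1 q, (2 * (j : ℚ) + 1) ^ (8 * (q - j) + 2) =
      (∏ j ∈ Finset.Ico 1 q, (2 * (j : ℚ) + 1) ^ (8 * (q - j) - 2)) *
        (∏ j ∈ Finset.Ico 1 q, (2 * (j : ℚ) + 1)) ^ 2 *
        (∏ j ∈ Finset.Icc 1 q, (2 * (j : ℚ) + 1)) ^ 2 := by
    rcases Nat.eq_zero_or_pos q with rfl | hq
    · simp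
    rw [← Finset.Ico_insert_right hq, Finset.prod_insert (by simp),
      Finset.prod_insert (by simp), Nat.sub_self, mul_pow, mul_zero, zero_add,
      ← Finset.prod_pow, mul_left_comm, ← Finset.prod_mul_distrib, ← Finset.prod_mul_distrib]
    congr 1
    refine Finset.prod_congr rfl fun j hj => ?_
    rw [Finset.mem_Ico] at hj
    rw [show 8 * (q - j) + 2 = 8 * (q - j) - 2 + 2 + 2 by omega, pow_add, pow_add]
  have hpow : (2 : ℚ) ^ ((2 * q) * (2 * q + 1)) = 2 ^ ((2 * q - 1) * (2 * q)) * (2 ^ q) ^ 4 := by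
    rw [← pow_mul, ← pow_add]
    congr 1
    rcases Nat.eq_zero_or_pos q with rfl | hq
    · simp
    obtain ⟨p, rfl⟩ : ∃ p, q = p + 1 := ⟨q - 1, by omega⟩
    rw [show 2 * (p + 1) - 1 = 2 * p + 1 by omega]
    ring
  have p1 : (∏ j ∈ Finset.Ico 1 q, (2 * (j : ℚ) + 1) ^ (8 * (q - j) - 2)) ≠ 0 :=
    Finset.prod_ne_zero_iff.2 fun j _ => by positivity
  have p2 : (∏ j ∈ Finset.Ico 1 q, (2 * (j : ℚ) + 1)) ≠ 0 :=
    Finset.prod_ne_zero_iff.2 fun j _ => by positivity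
  have p3 : (∏ j ∈ Finset.Icc 1 q, (2 * (j : ℚ) + 1)) ≠ 0 :=
    Finset.prod_ne_zero_iff.2 fun j _ => by positivity
  rw [oddFormula, evenFormula, hnum, hden, hpow, h1, h2]
  field_simp

theorem evenFormula_succ (n q : ℕ) :
    evenFormula n (q + 1) * ((2 * q + 1).factorial ^ 2 * (2 * q + 2).factorial ^ 2) =
      oddFormula n q * ((q + 1).factorial ^ 2 * q.factorial ^ 2 * centralProd n (q + 1) ^ 2) := by
  have h2 := (prod_range_odd q).2
  have h1 := (prod_range_odd (q + 1)).1
  rw [show Finset.Ico 1 (q + 1) = Finset.Icc 1 q from rfl, mul_add, mul_one] at h1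
  have hnum : ∏ i ∈ Finset.range (q + 1),
      (((n : ℚ) - i) * ((n : ℚ) + i + 1)) ^ (4 * (q + 1 - i) - 1) =
      (∏ i ∈ Finset.range (q + 1), (((n : ℚ) - i) * ((n : ℚ) + i + 1)) ^ (4 * (q - i) + 1)) *
        centralProd n (q + 1) ^ 2 := by
    rw [centralProd, ← Finset.prod_pow, ← Finset.prod_mul_distrib]
    refine Finset.prod_congr rfl fun i hi => ?_
    rw [Finset.mem_range] at hi
    rw [show 4 * (q + 1 - i) - 1 = 4 * (q - i) + 1 + 2 by omega, pow_add]
  have hden : ∏ j ∈ Finset.Ico 1 (q + 1), (2 * (j : ℚ) + 1) ^ (8 * (q + 1 - j) - 2) =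
      (∏ j ∈ Finset.Icc 1 q, (2 * (j : ℚ) + 1) ^ (8 * (q - j) + 2)) *
        (∏ j ∈ Finset.Icc 1 q, (2 * (j : ℚ) + 1)) ^ 4 := by
    rw [show Finset.Ico 1 (q + 1) = Finset.Icc 1 q from rfl, ← Finset.prod_pow,
      ← Finset.prod_mul_distrib]
    refine Finset.prod_congr rfl fun j hj => ?_
    rw [Finset.mem_Icc] at hj
    rw [show 8 * (q + 1 - j) - 2 = 8 * (q - j) + 2 + 4 by omega, pow_add]
  have hpow : (2 : ℚ) ^ ((2 * (q + 1) - 1) * (2 * (q + 1))) =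
      2 ^ ((2 * q) * (2 * q + 1)) * ((2 ^ q) ^ 2 * (2 ^ (q + 1)) ^ 2) := by
    rw [← pow_mul, ← pow_mul, ← pow_add, ← pow_add]
    congr 1
    rw [show 2 * (q + 1) - 1 = 2 * q + 1 by omega]
    ring
  have p1 : (∏ j ∈ Finset.Icc 1 q, (2 * (j : ℚ) + 1) ^ (8 * (q - j) + 2)) ≠ 0 :=
    Finset.prod_ne_zero_iff.2 fun j _ => by positivity
  have p3 : (∏ j ∈ Finset.Icc 1 q, (2 * (j : ℚ) + 1)) ≠ 0 :=
    Finset.prod_ne_zero_iff.2 fun j _ => by positivity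
  rw [oddFormula, evenFormula, hnum, hden, hpow, h1, h2]
  field_simp

/-- The absolute value of the Hankel determinant of the weight `y` on the squares of `1, …, n`. -/
def detOne (n m : ℕ) : ℚ :=
  ∏ i ∈ Finset.range m, ((i.factorial : ℚ) ^ 3 * centralProd n i * centralProd n (i + 1) /
    (i + m).factorial)

/-- The absolute value of the Hankel determinant of the weight `y ^ 3` on the squares of
`1, …, n`. -/
def detThree (n m : ℕ) : ℚ :=
  ∏ i ∈ Finset.range m, (((i + 1).factorial : ℚ) * i.factorial ^ 2 * centralProd n (i + 1) ^ 2 /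
    (i + m + 1).factorial)

/-- The window of factorials from `m + b` to `2 * m - 1 + b` moves to that from `m + 1 + b` to `2 *
m + 1 + b`: one is lost and two are gained. -/
theorem prod_factorial_add_succ (m b : ℕ) :
    (∏ i ∈ Finset.range (m + 1), ((i + (m + 1) + b).factorial : ℚ)) * (m + b).factorial =
      (∏ i ∈ Finset.range m, ((i + m + b).factorial : ℚ)) *
        ((2 * m + b).factorial * (2 * m + 1 + b).factorial) := by
  have h := Finset.prod_range_succ' (fun i => ((i + m + b).factorial : ℚ)) (m + 1)
  rw [Finset.prod_range_succ, Finset.prod_range_succ] at h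
  have h1 : ∀ i, ((i + 1 + m + b).factorial : ℚ) = (i + (m + 1) + b).factorial := fun i => by
    rw [show i + 1 + m + b = i + (m + 1) + b by ring]
  simp only [h1, zero_add] at h
  rw [← h, two_mul, show m + (m + 1) + b = m + m + 1 + b by ring]
  ring

theorem detOne_succ (n m : ℕ) :
    detOne n (m + 1) * ((2 * m).factorial * (2 * m + 1).factorial) =
      detOne n m * (m.factorial ^ 4 * centralProd n m * centralProd n (m + 1)) := by
  have h := prod_factorial_add_succ m 0
  simp only [add_zero] at h
  have p1 : (∏ i ∈ Finset.range (m + 1), ((i + (m + 1)).factorial : ℚ)) ≠ 0 :=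
    Finset.prod_ne_zero_iff.2 fun j _ => by positivity
  have p2 : (∏ i ∈ Finset.range m, ((i + m).factorial : ℚ)) ≠ 0 :=
    Finset.prod_ne_zero_iff.2 fun j _ => by positivity
  rw [detOne, detOne, Finset.prod_div_distrib, Finset.prod_div_distrib, div_mul_eq_mul_div,
    div_mul_eq_mul_div, div_eq_div_iff p1 p2, Finset.prod_range_succ]
  linear_combination (-(∏ i ∈ Finset.range m, ((i.factorial : ℚ) ^ 3 * centralProd n i *
    centralProd n (i + 1))) * (m.factorial ^ 3 * centralProd n m * centralProd n (m + 1))) * h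

theorem detThree_succ (n m : ℕ) :
    detThree n (m + 1) * ((2 * m + 1).factorial * (2 * m + 2).factorial) =
      detThree n m * ((m + 1).factorial ^ 2 * m.factorial ^ 2 * centralProd n (m + 1) ^ 2) := by
  have h := prod_factorial_add_succ m 1
  have p1 : (∏ i ∈ Finset.range (m + 1), ((i + (m + 1) + 1).factorial : ℚ)) ≠ 0 :=
    Finset.prod_ne_zero_iff.2 fun j _ => by positivity
  have p2 : (∏ i ∈ Finset.range m, ((i + m + 1).factorial : ℚ)) ≠ 0 :=
    Finset.prod_ne_zero_iff.2 fun j _ => by positivity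
  rw [detThree, detThree, Finset.prod_div_distrib, Finset.prod_div_distrib, div_mul_eq_mul_div,
    div_mul_eq_mul_div, div_eq_div_iff p1 p2, Finset.prod_range_succ]
  linear_combination (-(∏ i ∈ Finset.range m, (((i + 1).factorial : ℚ) * i.factorial ^ 2 *
    centralProd n (i + 1) ^ 2)) *
      ((m + 1).factorial * m.factorial ^ 2 * centralProd n (m + 1) ^ 2)) * h

/-- The product of the first `k` factorials. -/
def prodFactorial (k : ℕ) : ℚ := ∏ i ∈ Finset.range k, (i.factorial : ℚ)

theorem prodFactorial_succ (k : ℕ) : prodFactorial (k + 1) = prodFactorial k * k.factorial :=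
  Finset.prod_range_succ _ _

theorem prodFactorial_ne_zero (k : ℕ) : prodFactorial k ≠ 0 :=
  Finset.prod_ne_zero_iff.2 fun j _ => by positivity

/-- Raising `k` by one enlarges exactly one of the two determinants: `detOne` from even to odd `k`,
`detThree` from odd to even. Each step matches the corresponding ratio of formulas, starting from `k
= 0`. -/
theorem formula_mul_prodFactorial (n q : ℕ) :
    evenFormula n q * (prodFactorial (2 * q) * prodFactorial (2 * q + 1)) =
      detOne n q * detThree n q ∧
    oddFormula n q * (prodFactorial (2 * q + 1) * prodFactorial (2 * q + 2)) =
      detOne n (q + 1) * detThree n q := by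
  have hodd : ∀ q, evenFormula n q * (prodFactorial (2 * q) * prodFactorial (2 * q + 1)) =
      detOne n q * detThree n q →
      oddFormula n q * (prodFactorial (2 * q + 1) * prodFactorial (2 * q + 2)) =
      detOne n (q + 1) * detThree n q := by
    intro q h
    have h1 := oddFormula_eq n q
    have h2 := detOne_succ n q
    have f1 := cast_factorial_ne_zero (2 * q)
    have f2 := cast_factorial_ne_zero (2 * q + 1)
    rw [prodFactorial_succ (2 * q + 1)]
    rw [prodFactorial_succ (2 * q)] at *
    refine mul_right_cancel₀ (mul_ne_zero f1 f2) ?_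
    linear_combination (prodFactorial (2 * q)) ^ 2 * (2 * q).factorial * h1 +
      (q.factorial ^ 4 * centralProd n q * centralProd n (q + 1)) * h - detThree n q * h2
  have heven : ∀ q, oddFormula n q * (prodFactorial (2 * q + 1) * prodFactorial (2 * q + 2)) =
      detOne n (q + 1) * detThree n q →
      evenFormula n (q + 1) * (prodFactorial (2 * (q + 1)) * prodFactorial (2 * (q + 1) + 1)) =
      detOne n (q + 1) * detThree n (q + 1) := by
    intro q h
    have h1 := evenFormula_succ n q
    have h2 := detThree_succ n q
    have f1 := cast_factorial_ne_zero (2 * q + 1)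
    have f2 := cast_factorial_ne_zero (2 * q + 2)
    rw [show 2 * (q + 1) = 2 * q + 2 by ring, prodFactorial_succ (2 * q + 2)]
    rw [prodFactorial_succ (2 * q + 1)] at *
    refine mul_right_cancel₀ (mul_ne_zero f1 f2) ?_
    linear_combination (prodFactorial (2 * q + 1)) ^ 2 * (2 * q + 1).factorial * h1 +
      ((q + 1).factorial ^ 2 * q.factorial ^ 2 * centralProd n (q + 1) ^ 2) * h -
        detOne n (q + 1) * h2
  have hall : evenFormula n q * (prodFactorial (2 * q) * prodFactorial (2 * q + 1)) =
      detOne n q * detThree n q := by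
    induction q with
    | zero => simp [evenFormula, prodFactorial, detOne, detThree]
    | succ q ih => exact heven q (hodd q ih)
  exact ⟨hall, hodd q hall⟩

theorem mainTheorem2 (n k : ℕ) (hk : k ≤ 2 * n) :
    (∀ q : ℕ, k = 2 * q + 1 →
      (numTilingsNoCenter n k : ℚ) =
        (∏ i ∈ Finset.range (q + 1), (((n : ℚ) - i) * ((n : ℚ) + i + 1)) ^ (4 * (q - i) + 1)) /
          (2 ^ ((2 * q) * (2 * q + 1)) *
            ∏ j ∈ Finset.Icc 1 q, (2 * (j : ℚ) + 1) ^ (8 * (q - j) + 2))) ∧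
    (∀ q : ℕ, k = 2 * q →
      (numTilingsNoCenter n k : ℚ) =
        (∏ i ∈ Finset.range q, (((n : ℚ) - i) * ((n : ℚ) + i + 1)) ^ (4 * (q - i) - 1)) /
          (2 ^ ((2 * q - 1) * (2 * q)) *
            ∏ j ∈ Finset.Ico 1 q, (2 * (j : ℚ) + 1) ^ (8 * (q - j) - 2))) := by
  have h := numTilingsNoCenter_mul_eq_abs_det_mul hk
  rw [abs_det_pairing_one, abs_det_pairing_three (show k / 2 ≤ n by omega)] at h
  change _ * (prodFactorial k * prodFactorial (k + 1)) =
    detOne n ((k + 1) / 2) * detThree n (k / 2) at h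
  have h0 := mul_ne_zero (prodFactorial_ne_zero k) (prodFactorial_ne_zero (k + 1))
  constructor
  · rintro q rfl
    rw [show (2 * q + 1 + 1) / 2 = q + 1 by omega, show (2 * q + 1) / 2 = q by omega,
      ← (formula_mul_prodFactorial n q).2] at h
    exact mul_right_cancel₀ h0 h
  · rintro q rfl
    rw [show (2 * q + 1) / 2 = q by omega, show (2 * q) / 2 = q by omega,
      ← (formula_mul_prodFactorial n q).1] at h
    exact mul_right_cancel₀ h0 h
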